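/- Let $d\ge 1$ and $n\ge 0$ be integers. The framed Jones monoid $J_{d,n}$ is the monoid presented by generators $t_1,\dots,t_{n-1},z_1,\dots,z_n$ (no $t_i$ if $n\le 1$) and the relations \begin{align*} & t_i^2=t_i,\qquad t_it_j=t_jt_i \ \text{ if } |i-j|>1,\qquad t_it_jt_i=t_i\ \text{ if } |i-j|=1,\\ & z_i^d=1,\qquad z_iz_j=z_jz_i,\\ & t_iz_i=t_iz_{i+1},\qquad z_it_i=z_{i+1}t_i,\qquad z_it_j=t_jz_i\ \text{ if } i\neq j,j+1,\\ & t_iz_i^kt_i=t_i \ \text{ for all integers } k\ge 0 . \end{align*} An abacus diagram is a diagram, up to planar isotopy, of $n$ noncrossing arcs that join in pairs the points $1,\dots,n$ of the top segment and the points $1,\dots,n$ of the bottom segment of a strip, where each arc carries a number of beads in $\mathbb{Z}/d\mathbb{Z}$. The product of two abacus diagrams $D$ and $E$ is their concatenation ($D$ above $E$): the beads on each resulting arc are added modulo $d$, and the closed loops are discarded together with the beads on them. Then: 1. $J_{d,n}$ has exactly $d^n\cdot Cat_n$ elements, where $Cat_n=\frac{1}{n+1}\binom{2n}{n}$. 2.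 The abacus diagrams form a monoid $\mathring{J}_{d,n}$ under concatenation, whose unit is the diagram of $n$ vertical lines without beads. There is an isomorphism of monoids $J_{d,n}\to\mathring{J}_{d,n}$ that takes $t_i$ to the diagram without beads in which the points $i$ and $i+1$ are joined in the top segment and also in the bottom segment while all other arcs are vertical lines, and takes $z_i$ to the diagram of $n$ vertical lines with a single bead, on the line $i$. -/

import Mathlib

/-! ### The framed Jones monoid, by generators and relations -/

/-- The generators of the framed Jones monoid on `n` strands: tangles `t_1, …, t_{n-1}` and
framings `z_1, …, z_n` (indexed from `0` here). -/
inductive JonesGen (n : ℕ) : Type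
  | t (i : Fin (n - 1)) : JonesGen n
  | z (i : Fin n) : JonesGen n

/-- The strand `i`, the left one of the two strands which the tangle `t_i` acts on. -/
def leftStrand {n : ℕ} (i : Fin (n - 1)) : Fin n := ⟨i.1, by omega⟩

/-- The strand `i + 1`, the right one of the two strands which the tangle `t_i` acts on. -/
def rightStrand {n : ℕ} (i : Fin (n - 1)) : Fin n := ⟨i.1 + 1, by omega⟩

/-- The word of length one in the letter `t_i`. -/
def wordT {n : ℕ} (i : Fin (n - 1)) : FreeMonoid (JonesGen n) := FreeMonoid.of (JonesGen.t i)

/-- The word of length one in the letter `z_i`. -/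
def wordZ {n : ℕ} (i : Fin n) : FreeMonoid (JonesGen n) := FreeMonoid.of (JonesGen.z i)

/-- The defining relations of the framed Jones monoid. -/
inductive FramedJonesRel (d n : ℕ) : FreeMonoid (JonesGen n) → FreeMonoid (JonesGen n) → Prop
  | t_sq (i : Fin (n - 1)) :
      FramedJonesRel d n (wordT i ^ 2) (wordT i)
  | t_comm (i j : Fin (n - 1)) (h : i.1 + 1 < j.1 ∨ j.1 + 1 < i.1) :
      FramedJonesRel d n (wordT i * wordT j) (wordT j * wordT i)
  | t_t_t (i j : Fin (n - 1)) (h : i.1 + 1 = j.1 ∨ j.1 + 1 = i.1) :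
      FramedJonesRel d n (wordT i * wordT j * wordT i) (wordT i)
  | z_pow (i : Fin n) :
      FramedJonesRel d n (wordZ i ^ d) 1
  | z_comm (i j : Fin n) :
      FramedJonesRel d n (wordZ i * wordZ j) (wordZ j * wordZ i)
  | t_z (i : Fin (n - 1)) :
      FramedJonesRel d n (wordT i * wordZ (leftStrand i)) (wordT i * wordZ (rightStrand i))
  | z_t (i : Fin (n - 1)) :
      FramedJonesRel d n (wordZ (leftStrand i) * wordT i) (wordZ (rightStrand i) * wordT i)
  | z_t_comm (i : Fin n) (j : Fin (n - 1)) (hl : i ≠ leftStrand j) (hr : i ≠ rightStrand j) :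
      FramedJonesRel d n (wordZ i * wordT j) (wordT j * wordZ i)
  | t_z_t (i : Fin (n - 1)) (k : ℕ) :
      FramedJonesRel d n (wordT i * wordZ (leftStrand i) ^ k * wordT i) (wordT i)

/-- The framed Jones monoid `J_{d,n}`. -/
abbrev FramedJones (d n : ℕ) : Type := PresentedMonoid (FramedJonesRel d n)

/-- The generator `t_i` of `J_{d,n}`. -/
def FramedJones.t (d : ℕ) {n : ℕ} (i : Fin (n - 1)) : FramedJones d n :=
  PresentedMonoid.of (FramedJonesRel d n) (JonesGen.t i)

/-- The generator `z_i` of `J_{d,n}`. -/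
def FramedJones.z (d : ℕ) {n : ℕ} (i : Fin n) : FramedJones d n :=
  PresentedMonoid.of (FramedJonesRel d n) (JonesGen.z i)

/-! ### Abacus Jones diagrams -/

/-- The endpoints of a diagram: `Sum.inl i` is the point `i` of the top segment, `Sum.inr i` the
point `i` of the bottom segment. -/
abbrev EndPt (n : ℕ) : Type := Fin n ⊕ Fin n

/-- The place of an endpoint on the boundary of the strip: along the top segment from left to
right, then along the bottom segment from right to left. -/
def boundaryPos {n : ℕ} : EndPt n → ℕ
  | Sum.inl i => i.1
  | Sum.inr i => 2 * n - 1 - i.1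

/-- A diagram of `n` noncrossing arcs which join the `2 n` endpoints in pairs, where each arc
carries a number of beads, counted modulo `d`. Diagrams are taken up to planar isotopy, so that
only the pairing of the endpoints and the number of beads on each arc matter. -/
@[ext]
structure AbacusDiagram (d n : ℕ) : Type where
  /-- the other endpoint of the arc that ends at a given point -/
  arc : EndPt n → EndPt n
  /-- the number modulo `d` of beads on the arc that ends at a given point -/
  beads : EndPt n → ZMod d
  arc_arc : ∀ p, arc (arc p) = p
  arc_ne : ∀ p, arc p ≠ p
  noncrossing : ∀ p q, ¬ (boundaryPos p < boundaryPos q ∧ boundaryPos q < boundaryPos (arc p) ∧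
    boundaryPos (arc p) < boundaryPos (arc q))
  beads_arc : ∀ p, beads (arc p) = beads p

namespace AbacusDiagram

/-- The identity diagram: `n` vertical lines without beads. -/
def idDiagram (d n : ℕ) : AbacusDiagram d n where
  arc := Sum.swap
  beads := fun _ => 0
  arc_arc := Sum.swap_swap
  arc_ne := by rintro (i | i) <;> simp
  noncrossing := by
    rintro (i | i) (j | j) <;> simp only [boundaryPos, Sum.swap_inl, Sum.swap_inr] <;> omega
  beads_arc := fun _ => rfl

/-- The diagram of `n` vertical lines with a single bead, on the line `i`. -/
def bead (d : ℕ) {n : ℕ} (i : Fin n) : AbacusDiagram d n where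
  arc := Sum.swap
  beads := Sum.elim (fun j => if j = i then 1 else 0) (fun j => if j = i then 1 else 0)
  arc_arc := Sum.swap_swap
  arc_ne := by rintro (i | i) <;> simp
  noncrossing := by
    rintro (i | i) (j | j) <;> simp only [boundaryPos, Sum.swap_inl, Sum.swap_inr] <;> omega
  beads_arc := by rintro (j | j) <;> rfl

/-- The pairing of the tangle `t_i`: one bracket joins the points `i` and `i + 1` of the top
segment, one bracket those of the bottom segment, and all other arcs are vertical lines. -/
def tangleArc {n : ℕ} (i : Fin (n - 1)) : EndPt n → EndPt n
  | Sum.inl j =>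
      if j = leftStrand i then Sum.inl (rightStrand i)
      else if j = rightStrand i then Sum.inl (leftStrand i)
      else Sum.inr j
  | Sum.inr j =>
      if j = leftStrand i then Sum.inr (rightStrand i)
      else if j = rightStrand i then Sum.inr (leftStrand i)
      else Sum.inl j

theorem leftStrand_ne_rightStrand {n : ℕ} (i : Fin (n - 1)) :
    leftStrand i ≠ rightStrand i := by
  simp [leftStrand, rightStrand]

/-- The tangle diagram, without beads. -/
def tangle (d : ℕ) {n : ℕ} (i : Fin (n - 1)) : AbacusDiagram d n where
  arc := tangleArc i
  beads := fun _ => 0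
  arc_arc := by
    have h := leftStrand_ne_rightStrand i
    rintro (j | j) <;> simp only [tangleArc] <;> split_ifs <;> simp_all [tangleArc, h.symm]
  arc_ne := by
    have h := leftStrand_ne_rightStrand i
    rintro (j | j) <;> simp only [tangleArc] <;> split_ifs <;> simp_all [h.symm]
  noncrossing := by
    have hi := i.2
    rintro (j | j) (k | k) <;> have hj := j.2 <;> have hk := k.2 <;>
      simp only [tangleArc, Fin.ext_iff, leftStrand, rightStrand] <;> split_ifs <;>
      simp only [boundaryPos] <;> omega
  beads_arc := fun _ => rfl

/-- Stack `D` on top of `E`, gluing the bottom point `j` of `D` to the top point `j` of `E`.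
`Strand D E s q b` says: the strand that starts along the arc of `D` at its endpoint `p` (if
`s = Sum.inl p`), or along the arc of `E` at its endpoint `p` (if `s = Sum.inr p`), and goes on
through the glued points, ends at the point `q` of the outer boundary of the stack, and the beads
on it add up to `b`. -/
inductive Strand {d n : ℕ} (D E : AbacusDiagram d n) :
    EndPt n ⊕ EndPt n → EndPt n → ZMod d → Prop
  | exit_top (p : EndPt n) (j : Fin n) (h : D.arc p = Sum.inl j) :
      Strand D E (Sum.inl p) (Sum.inl j) (D.beads p)
  | go_down (p : EndPt n) (j : Fin n) (h : D.arc p = Sum.inr j) (q : EndPt n) (b : ZMod d)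
      (hs : Strand D E (Sum.inr (Sum.inl j)) q b) :
      Strand D E (Sum.inl p) q (D.beads p + b)
  | exit_bottom (p : EndPt n) (j : Fin n) (h : E.arc p = Sum.inr j) :
      Strand D E (Sum.inr p) (Sum.inr j) (E.beads p)
  | go_up (p : EndPt n) (j : Fin n) (h : E.arc p = Sum.inl j) (q : EndPt n) (b : ZMod d)
      (hs : Strand D E (Sum.inl (Sum.inr j)) q b) :
      Strand D E (Sum.inr p) q (E.beads p + b)

/-- `F` is the concatenation of `D` (above) and `E` (below): its arcs are the strands of the stack
that join points of the outer boundary, with the beads on them added modulo `d`. Closed loops in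
the middle, with the beads on them, are discarded. -/
def IsConcat {d n : ℕ} (D E F : AbacusDiagram d n) : Prop :=
  (∀ i : Fin n, Strand D E (Sum.inl (Sum.inl i)) (F.arc (Sum.inl i)) (F.beads (Sum.inl i))) ∧
  (∀ i : Fin n, Strand D E (Sum.inr (Sum.inr i)) (F.arc (Sum.inr i)) (F.beads (Sum.inr i)))

end AbacusDiagram

/-! The monoid is compared with the diagrams through a right action. A word acts by attaching its
letters at the bottom of a diagram: `t_i` reconnects the arcs at two adjacent bottom points and
places a bracket below them (`mulTangle`), and `z_i` adds a bead (`addBeads`). The defining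
relations hold for this action (`mulWord_eq_of_rel`), so `FramedJones d n` acts, and `ofJones x` is
the identity diagram acted on by `x`. What has to be shown is that `ofJones` is bijective and that
it turns products into concatenations.

Numbering the endpoints along the boundary of the strip makes a diagram without beads a noncrossing
matching of `2 * n` positions. Such a matching of `2 * (n + 1)` positions has an arc `(m, m + 1)`
with `n ≤ m`. Removing it and recording the descending product `t (n - 1) * … * t (2 * n - m)`
gives, by recursion, a word in the `t_i`. Its value does not depend on the chosen arc
(`toProd_insertArc`), and right multiplication by `t_i` takes the word of a matching to the word of
the matching with a tangle attached (`toProd_mul`, `toProd_insertArc_contract`). This is the case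
without beads.

For the beads, `act α x` multiplies `x` by powers of the `z_i` on both sides, placing `α p` beads at
each endpoint `p`. Beads slide along the arcs of `ofJones x` (`act_single_arc`), so `act α x`
depends on `α` only through its sums over the arcs (`act_eq_act`). Induction on `x` then gives `x =
act α (ofMatching …)`, where matching and arc sums are those of `ofJones x` (`eq_act_ofMatching`).
Hence the diagram determines `x`. Conversely, each matching is realised by its word
(`toMatching_ofJones_ofMatching`), and `act` corrects the beads.

Concatenation is respected because attaching a letter below a stack is the same as attaching it to
the lower diagram (`isConcat_ofJones_mul`). In particular, no separate argument is needed that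
strands end. For the count, matchings correspond to Dyck words, and each of the `n` arcs of a
diagram carries an independent element of `ZMod d`. -/

/-! ### Noncrossing matchings on a line: inserting and contracting adjacent positions -/

/-- A noncrossing perfect matching of the positions `0, …, 2 n - 1` on a line. -/
@[ext]
structure NCMatching (n : ℕ) : Type where
  /-- the position that a position is matched with; positions from `2 n` on are fixed -/
  mate : ℕ → ℕ
  mate_mate : ∀ k, mate (mate k) = k
  mate_ne : ∀ k, k < 2 * n → mate k ≠ k
  mate_of_le : ∀ k, 2 * n ≤ k → mate k = k
  noncrossing : ∀ a k, a < k → k < mate a → a < mate k ∧ mate k < mate a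

/-- Move the positions from `m` on by two places, to make room for `m` and `m + 1`. -/
def shiftUp (m k : ℕ) : ℕ := if k < m then k else k + 2

/-- Remove the positions `m` and `m + 1`. -/
def shiftDown (m k : ℕ) : ℕ := if k < m then k else k - 2

/-- Change an involution such that it swaps `p` and `q`, and swaps their former partners. -/
def capArc {α : Type*} [DecidableEq α] (f : α → α) (p q x : α) : α :=
  if x = p then q else if x = q then p
  else if f x = p then f q else if f x = q then f p else f x

theorem capArc_spec {α : Type*} [DecidableEq α] (f : α → α) (p q x : α) :
    (x = p ∧ capArc f p q x = q) ∨ (x ≠ p ∧ x = q ∧ capArc f p q x = p) ∨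
    (x ≠ p ∧ x ≠ q ∧ f x = p ∧ capArc f p q x = f q) ∨
    (x ≠ p ∧ x ≠ q ∧ f x ≠ p ∧ f x = q ∧ capArc f p q x = f p) ∨
    (x ≠ p ∧ x ≠ q ∧ f x ≠ p ∧ f x ≠ q ∧ capArc f p q x = f x) := by
  unfold capArc
  split_ifs <;> simp_all

@[simp]
theorem capArc_left {α : Type*} [DecidableEq α] (f : α → α) (p q : α) :
    capArc f p q p = q := by
  simp [capArc]

@[simp]
theorem capArc_right {α : Type*} [DecidableEq α] (f : α → α) (p q : α) :
    capArc f p q q = p := by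
  unfold capArc
  split_ifs <;> simp_all

theorem capArc_capArc {α : Type*} [DecidableEq α] {f : α → α} (hf : ∀ x, f (f x) = x)
    {p q : α} (hp : f p ≠ p) (hq : f q ≠ q) (x : α) : capArc f p q (capArc f p q x) = x := by
  have h1 := capArc_spec f p q x
  have h2 := capArc_spec f p q (capArc f p q x)
  have := hf x
  have := hf p
  have := hf q
  generalize capArc f p q (capArc f p q x) = z at *
  generalize capArc f p q x = y at *
  rcases h1 with h | h | h | h | h <;> rcases h2 with h' | h' | h' | h' | h' <;> grind

theorem capArc_ne {α : Type*} [DecidableEq α] {f : α → α} (hf : ∀ x, f (f x) = x)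
    {p q : α} (hpq : p ≠ q) {x : α} (hne : f x ≠ x) : capArc f p q x ≠ x := by
  have h1 := capArc_spec f p q x
  have := hf x
  grind

theorem capArc_map {α β : Type*} [DecidableEq α] [DecidableEq β] {u : α → β}
    (hu : Function.Injective u) {f : α → α} {g : β → β} (h : ∀ x, g (u x) = u (f x)) (p q x : α) :
    capArc g (u p) (u q) (u x) = u (capArc f p q x) := by
  simp only [capArc, h, hu.eq_iff]
  split_ifs <;> rfl

/-- The new arc follows one old arc to `m`, steps to the neighbour `m + 1`, and follows another old
arc. No position lies between `m` and `m + 1`, so a crossing with it would give a crossing of old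
arcs. -/
theorem capArc_noncrossing {f : ℕ → ℕ} (hf : ∀ x, f (f x) = x)
    (nc : ∀ a k, a < k → k < f a → a < f k ∧ f k < f a) {m : ℕ}
    (hm' : f (m + 1) ≠ m + 1) (a k : ℕ) (h1 : a < k) (h2 : k < capArc f m (m + 1) a) :
    a < capArc f m (m + 1) k ∧ capArc f m (m + 1) k < capArc f m (m + 1) a := by
  have ha : ∀ y, f a = y → f y = a := by rintro _ rfl; exact hf a
  have hk : ∀ y, f k = y → f y = k := by rintro _ rfl; exact hf k
  have c1 := nc a k
  rcases capArc_spec f m (m + 1) a with ⟨sa, ra⟩ | ⟨_, sa, ra⟩ | ⟨_, _, sa, ra⟩ |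
      ⟨_, _, _, sa, ra⟩ | ⟨_, _, sa, sa', ra⟩ <;>
    rcases capArc_spec f m (m + 1) k with ⟨sk, rk⟩ | ⟨_, sk, rk⟩ | ⟨_, _, sk, rk⟩ |
      ⟨_, _, _, sk, rk⟩ | ⟨_, _, sk, sk', rk⟩ <;>
    rw [ra] at h2 ⊢ <;> rw [rk] <;> clear ra rk
  any_goals omega
  any_goals
    have e1 := ha _ sa
    have e2 := hk _ sk
    clear ha hk
    omega
  · have e1 := ha _ sa
    have b1 := nc a (f (m + 1))
    have b2 := nc (m + 1) k
    have b3 := nc m (m + 1)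
    rw [hf] at b1
    clear ha hk
    omega
  · have b1 := nc a m
    rw [sk] at h1 h2
    clear ha hk c1
    omega
  · have e1 := ha _ sa
    have b1 := nc a m
    have b2 := nc k (f m)
    have b3 := nc m k
    have b4 := nc (f k) a
    have e2 := hk a
    have e3 := hk (f m)
    rw [hf] at b2 b4 e3
    clear ha hk
    omega
  · have b1 := nc a (m + 1)
    clear ha hk
    omega
  · have b1 := nc a m
    clear ha hk
    omega

theorem shiftUp_injective (m : ℕ) : Function.Injective (shiftUp m) := by
  intro a b h
  unfold shiftUp at h
  split_ifs at h <;> omega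

@[simp]
theorem shiftDown_shiftUp (m k : ℕ) : shiftDown m (shiftUp m k) = k := by
  unfold shiftUp shiftDown
  split_ifs <;> omega

theorem shiftUp_ne (m k : ℕ) : shiftUp m k ≠ m ∧ shiftUp m k ≠ m + 1 := by
  unfold shiftUp
  split_ifs <;> omega

theorem shiftUp_lt_iff {m a b : ℕ} : shiftUp m a < shiftUp m b ↔ a < b := by
  unfold shiftUp
  split_ifs <;> omega

theorem eq_or_exists_shiftUp (m k : ℕ) : k = m ∨ k = m + 1 ∨ ∃ l, k = shiftUp m l := by
  by_cases h1 : k < m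
  · exact .inr (.inr ⟨k, by simp [shiftUp, h1]⟩)
  · by_cases h2 : m + 2 ≤ k
    · refine .inr (.inr ⟨k - 2, ?_⟩)
      unfold shiftUp
      split_ifs <;> omega
    · omega

theorem shiftUp_shiftUp {m l : ℕ} (h : m ≤ l) (k : ℕ) :
    shiftUp (l + 2) (shiftUp m k) = shiftUp m (shiftUp l k) := by
  unfold shiftUp
  split_ifs <;> omega

theorem shiftUp_of_lt {m k : ℕ} (h : k < m) : shiftUp m k = k := if_pos h

theorem shiftUp_of_le {m k : ℕ} (h : m ≤ k) : shiftUp m k = k + 2 := if_neg (not_lt.2 h)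

namespace NCMatching

variable {n : ℕ}

theorem mate_lt (M : NCMatching n) {k : ℕ} (hk : k < 2 * n) : M.mate k < 2 * n := by
  by_contra h
  have h1 := M.mate_of_le _ (not_lt.1 h)
  rw [M.mate_mate] at h1
  omega

/-- The involution which swaps `m` and `m + 1`, and is `f` on the other positions. -/
def insertFun (m : ℕ) (f : ℕ → ℕ) (k : ℕ) : ℕ :=
  if k = m then m + 1 else if k = m + 1 then m else shiftUp m (f (shiftDown m k))

@[simp]
theorem insertFun_self (m : ℕ) (f : ℕ → ℕ) : insertFun m f m = m + 1 := by
  simp [insertFun]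

@[simp]
theorem insertFun_succ (m : ℕ) (f : ℕ → ℕ) : insertFun m f (m + 1) = m := by
  simp [insertFun]

@[simp]
theorem insertFun_shiftUp (m : ℕ) (f : ℕ → ℕ) (k : ℕ) :
    insertFun m f (shiftUp m k) = shiftUp m (f k) := by
  simp [insertFun, shiftUp_ne]

/-- Insert two new positions `m` and `m + 1`, matched with each other. -/
def insertArc (m : ℕ) (hm : m ≤ 2 * n) (M : NCMatching n) : NCMatching (n + 1) where
  mate := insertFun m M.mate
  mate_mate k := by
    rcases eq_or_exists_shiftUp m k with rfl | rfl | ⟨l, rfl⟩ <;> simp [M.mate_mate]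
  mate_ne k hk := by
    rcases eq_or_exists_shiftUp m k with rfl | rfl | ⟨l, rfl⟩
    · simp
    · simp
    · rw [insertFun_shiftUp, (shiftUp_injective m).ne_iff]
      apply M.mate_ne
      unfold shiftUp at hk
      split_ifs at hk <;> omega
  mate_of_le k hk := by
    obtain ⟨l, rfl⟩ : ∃ l, k = l + 2 := ⟨k - 2, by omega⟩
    rw [← shiftUp_of_le (m := m) (by omega), insertFun_shiftUp, M.mate_of_le _ (by omega)]
  noncrossing a k := by
    rcases eq_or_exists_shiftUp m a with h | h | ⟨a, rfl⟩ <;>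
      rcases eq_or_exists_shiftUp m k with h' | h' | ⟨k, rfl⟩
    any_goals simp only [h, insertFun_self, insertFun_succ]; omega
    · have := shiftUp_ne m (M.mate a)
      simp only [h', insertFun_shiftUp, insertFun_self]
      omega
    · have := shiftUp_ne m a
      simp only [h', insertFun_shiftUp, insertFun_succ]
      omega
    · simpa only [insertFun_shiftUp, shiftUp_lt_iff] using M.noncrossing a k

@[simp]
theorem insertArc_mate_self (m : ℕ) (hm : m ≤ 2 * n) (M : NCMatching n) :
    (insertArc m hm M).mate m = m + 1 := insertFun_self _ _

@[simp]
theorem insertArc_mate_succ (m : ℕ) (hm : m ≤ 2 * n) (M : NCMatching n) :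
    (insertArc m hm M).mate (m + 1) = m := insertFun_succ _ _

@[simp]
theorem insertArc_mate_shiftUp (m : ℕ) (hm : m ≤ 2 * n) (M : NCMatching n) (k : ℕ) :
    (insertArc m hm M).mate (shiftUp m k) = shiftUp m (M.mate k) := insertFun_shiftUp _ _ _

theorem mate_ne_of_le {m : ℕ} (hm : m ≤ 2 * n) (M : NCMatching (n + 1)) : M.mate m ≠ m :=
  M.mate_ne m (by omega)

theorem mate_succ_ne_of_le {m : ℕ} (hm : m ≤ 2 * n) (M : NCMatching (n + 1)) :
    M.mate (m + 1) ≠ m + 1 :=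
  M.mate_ne (m + 1) (by omega)

theorem capArc_mate_capArc_mate {m : ℕ} (hm : m ≤ 2 * n) (M : NCMatching (n + 1)) (k : ℕ) :
    capArc M.mate m (m + 1) (capArc M.mate m (m + 1) k) = k :=
  capArc_capArc M.mate_mate (M.mate_ne_of_le hm) (M.mate_succ_ne_of_le hm) k

/-- The involution in which the former partners of `m` and `m + 1` are matched, and `m` and
`m + 1` are removed. -/
def contractFun (m : ℕ) (f : ℕ → ℕ) (k : ℕ) : ℕ :=
  shiftDown m (capArc f m (m + 1) (shiftUp m k))

theorem shiftUp_contractFun {m : ℕ} (hm : m ≤ 2 * n) (M : NCMatching (n + 1)) (k : ℕ) :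
    shiftUp m (contractFun m M.mate k) = capArc M.mate m (m + 1) (shiftUp m k) := by
  have h := M.capArc_mate_capArc_mate hm (shiftUp m k)
  have h' := shiftUp_ne m k
  unfold contractFun
  rcases eq_or_exists_shiftUp m (capArc M.mate m (m + 1) (shiftUp m k)) with h1 | h1 | ⟨l, hl⟩
  · rw [h1, capArc_left] at h
    exact absurd h.symm h'.2
  · rw [h1, capArc_right] at h
    exact absurd h.symm h'.1
  · rw [hl, shiftDown_shiftUp]

/-- Join the positions `m` and `m + 1` from outside the line, and remove them. -/
def contract (m : ℕ) (hm : m ≤ 2 * n) (M : NCMatching (n + 1)) : NCMatching n where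
  mate := contractFun m M.mate
  mate_mate k := shiftUp_injective m (by
    simp only [shiftUp_contractFun hm, capArc_mate_capArc_mate hm])
  mate_ne k hk := by
    rw [← (shiftUp_injective m).ne_iff, shiftUp_contractFun hm]
    refine capArc_ne M.mate_mate (by omega) (M.mate_ne _ ?_)
    unfold shiftUp
    split_ifs <;> omega
  mate_of_le k hk := shiftUp_injective m (by
    rw [shiftUp_contractFun hm, shiftUp_of_le (by omega)]
    have h' := M.mate_of_le (k + 2) (by omega)
    rcases capArc_spec M.mate m (m + 1) (k + 2) with h | h | h | h | h <;> omega)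
  noncrossing a k h1 h2 := by
    have h := capArc_noncrossing M.mate_mate M.noncrossing (M.mate_succ_ne_of_le hm)
      (shiftUp m a) (shiftUp m k)
    simp only [← shiftUp_contractFun hm, shiftUp_lt_iff] at h
    exact h h1 h2

theorem shiftUp_contract_mate (m : ℕ) (hm : m ≤ 2 * n) (M : NCMatching (n + 1)) (k : ℕ) :
    shiftUp m ((contract m hm M).mate k) = capArc M.mate m (m + 1) (shiftUp m k) :=
  shiftUp_contractFun hm _ _

theorem insertArc_contract_mate (m : ℕ) (hm : m ≤ 2 * n) (M : NCMatching (n + 1)) (k : ℕ) :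
    (insertArc m hm (contract m hm M)).mate k = capArc M.mate m (m + 1) k := by
  rcases eq_or_exists_shiftUp m k with rfl | rfl | ⟨l, rfl⟩
  · simp
  · simp
  · rw [insertArc_mate_shiftUp, shiftUp_contract_mate]

theorem eq_contract {m : ℕ} {hm : m ≤ 2 * n} {M : NCMatching (n + 1)} {A : NCMatching n}
    (h : ∀ k, capArc M.mate m (m + 1) (shiftUp m k) = shiftUp m (A.mate k)) :
    contract m hm M = A := by
  ext k
  apply shiftUp_injective m
  rw [shiftUp_contract_mate, h]

theorem contract_insertArc (m : ℕ) (hm : m ≤ 2 * n) (M : NCMatching n) :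
    contract m hm (insertArc m hm M) = M := by
  refine eq_contract fun k ↦ ?_
  have h := shiftUp_ne m k
  have h' := shiftUp_ne m (M.mate k)
  simp [capArc, h, h']

/-- Pulling a zigzag straight: the partner of `m + 2` is joined through `m + 2, m + 1` to `m`, so
the position that survives takes over the old arc. `contract_insertArc_succ` is the mirror image. -/
theorem contract_succ_insertArc (m : ℕ) (hm : m ≤ 2 * n) (hm' : m + 1 ≤ 2 * n)
    (M : NCMatching n) : contract (m + 1) hm' (insertArc m hm M) = M := by
  refine eq_contract fun k ↦ ?_
  have e : m + 1 + 1 = shiftUp m m := (shiftUp_of_le le_rfl).symm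
  rcases eq_or_ne k m with rfl | hk
  · rw [shiftUp_of_lt (by omega : k < k + 1)]
    have h := shiftUp_ne k (M.mate k)
    have h' : M.mate k ≠ k := M.mate_ne k (by omega)
    rw [e]
    simp only [capArc, insertArc_mate_self, insertArc_mate_succ, insertArc_mate_shiftUp]
    unfold shiftUp
    grind
  · have h1 : shiftUp (m + 1) k = shiftUp m k := by unfold shiftUp; grind
    have h2 := shiftUp_ne m (M.mate k)
    have h3 := shiftUp_ne m k
    have h4 := M.mate_mate k
    rw [h1, e]
    simp only [capArc, insertArc_mate_succ, insertArc_mate_shiftUp,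
      (shiftUp_injective m).eq_iff, h2, h3, hk, if_false]
    split_ifs with h5
    · rw [h5, shiftUp_of_lt (by omega)]
    · unfold shiftUp
      grind

theorem contract_insertArc_succ (m : ℕ) (hm : m ≤ 2 * n) (hm' : m + 1 ≤ 2 * n)
    (M : NCMatching n) : contract m hm (insertArc (m + 1) hm' M) = M := by
  refine eq_contract fun k ↦ ?_
  have e : shiftUp (m + 1) m = m := (shiftUp_of_lt (by omega))
  have e' := M.mate_ne m (by omega)
  rcases eq_or_ne k m with rfl | hk
  · rw [shiftUp_of_le le_rfl]
    have h := insertArc_mate_shiftUp (k + 1) hm' M k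
    rw [e] at h
    simp only [capArc, insertArc_mate_self, insertArc_mate_succ, h]
    unfold shiftUp
    grind
  · have h1 : shiftUp m k = shiftUp (m + 1) k := by unfold shiftUp; grind
    have h := insertArc_mate_shiftUp (m + 1) hm' M m
    rw [e] at h
    have h2 := shiftUp_ne (m + 1) (M.mate k)
    have h3 := shiftUp_ne (m + 1) k
    have h4 : shiftUp (m + 1) k ≠ m := by unfold shiftUp; grind
    rw [h1]
    simp only [capArc, insertArc_mate_self, insertArc_mate_shiftUp,
      h2, h3, h4, if_false]
    unfold shiftUp
    grind

/-- Operations at disjoint pairs of positions commute; the shift by two accounts for the pair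
inserted further left. -/
theorem contract_insertArc_of_le (m l : ℕ) (hm : m ≤ l) (hl : l ≤ 2 * n)
    (M : NCMatching (n + 1)) :
    contract (l + 2) (by omega) (insertArc m (by omega) M) =
      insertArc m (hm.trans hl) (contract l hl M) := by
  refine eq_contract fun k ↦ ?_
  have e1 : l + 2 = shiftUp m l := (shiftUp_of_le hm).symm
  have e2 : l + 2 + 1 = shiftUp m (l + 1) := (shiftUp_of_le (by omega)).symm
  rcases eq_or_exists_shiftUp m k with rfl | rfl | ⟨k, rfl⟩
  · rw [shiftUp_of_lt (by omega), insertArc_mate_self, shiftUp_of_lt (by omega)]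
    unfold capArc
    simp only [insertArc_mate_self]
    grind
  · rw [shiftUp_of_lt (by omega), insertArc_mate_succ, shiftUp_of_lt (by omega)]
    unfold capArc
    simp only [insertArc_mate_succ]
    grind
  · rw [shiftUp_shiftUp hm, insertArc_mate_shiftUp, shiftUp_shiftUp hm, shiftUp_contract_mate,
      e2, e1]
    exact capArc_map (shiftUp_injective m) (insertArc_mate_shiftUp m _ M) _ _ _

theorem contract_insertArc_of_ge (m l : ℕ) (hm : m ≤ l) (hl : l ≤ 2 * n)
    (M : NCMatching (n + 1)) :
    contract m (by omega) (insertArc (l + 2) (by omega) M) =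
      insertArc l hl (contract m (hm.trans hl) M) := by
  refine eq_contract fun k ↦ ?_
  have e1 : shiftUp (l + 2) m = m := shiftUp_of_lt (by omega)
  have e2 : shiftUp (l + 2) (m + 1) = m + 1 := shiftUp_of_lt (by omega)
  rcases eq_or_exists_shiftUp l k with rfl | rfl | ⟨l', rfl⟩
  · rw [shiftUp_of_le hm, insertArc_mate_self, shiftUp_of_le (by omega)]
    unfold capArc
    simp only [insertArc_mate_self]
    grind
  · rw [shiftUp_of_le (by omega), insertArc_mate_succ, shiftUp_of_le hm]
    unfold capArc
    simp only [show l + 1 + 2 = l + 2 + 1 by omega, insertArc_mate_succ]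
    grind
  · rw [← shiftUp_shiftUp hm, insertArc_mate_shiftUp, ← shiftUp_shiftUp hm, shiftUp_contract_mate]
    have := capArc_map (shiftUp_injective (l + 2)) (insertArc_mate_shiftUp (l + 2) (by omega) M)
      m (m + 1) (shiftUp m l')
    rwa [e1, e2] at this

theorem insertArc_insertArc (m l : ℕ) (hm : m ≤ l) (hl : l ≤ 2 * n) (M : NCMatching n) :
    insertArc (l + 2) (by omega) (insertArc m (hm.trans hl) M) =
      insertArc m (by omega) (insertArc l hl M) := by
  ext k
  rcases eq_or_exists_shiftUp m k with rfl | rfl | ⟨k, rfl⟩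
  · have h := insertArc_mate_shiftUp (l + 2) (by omega) (insertArc k (hm.trans hl) M) k
    rw [insertArc_mate_self, shiftUp_of_lt (by omega), shiftUp_of_lt (by omega)] at h
    rw [h, insertArc_mate_self]
  · have h := insertArc_mate_shiftUp (l + 2) (by omega) (insertArc m (hm.trans hl) M) (m + 1)
    rw [insertArc_mate_succ, shiftUp_of_lt (by omega), shiftUp_of_lt (by omega)] at h
    rw [h, insertArc_mate_succ]
  · rw [insertArc_mate_shiftUp]
    rcases eq_or_exists_shiftUp l k with rfl | rfl | ⟨k, rfl⟩
    · rw [insertArc_mate_self, shiftUp_of_le hm, shiftUp_of_le (by omega), insertArc_mate_self]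
    · rw [insertArc_mate_succ, shiftUp_of_le hm, shiftUp_of_le (by omega)]
      exact insertArc_mate_succ _ _ _
    · rw [insertArc_mate_shiftUp, ← shiftUp_shiftUp hm, ← shiftUp_shiftUp hm,
        insertArc_mate_shiftUp, insertArc_mate_shiftUp]

/-- If the arc from `k` is not short, the arc from `k + 1` is nested inside it and opens to the
right, so it is strictly shorter. The bound `a` persists because left ends only move right. -/
theorem exists_innermost (M : NCMatching n) {a : ℕ} (k : ℕ) (hk : a ≤ k) (hk' : k < M.mate k) :
    ∃ m, a ≤ m ∧ M.mate m = m + 1 := by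
  obtain ⟨r, hr⟩ : ∃ r, M.mate k - k = r := ⟨_, rfl⟩
  induction r using Nat.strong_induction_on generalizing k with
  | _ r ih =>
    by_cases h : M.mate k = k + 1
    · exact ⟨k, hk, h⟩
    · have h1 := M.noncrossing k (k + 1) (by omega) (by omega)
      have h2 : k + 1 < 2 * n := by
        by_contra h3
        have := M.mate_of_le (k + 1) (by omega)
        have := M.mate_of_le (M.mate k) (by omega)
        rw [M.mate_mate] at this
        omega
      have h3 := M.mate_ne (k + 1) h2
      exact ih (M.mate (k + 1) - (k + 1)) (by omega) (k + 1) (by omega) (by omega) rfl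

theorem lt_of_mate_eq_succ (M : NCMatching n) {m : ℕ} (h : M.mate m = m + 1) :
    m + 1 < 2 * n := by
  by_contra h1
  have h2 := M.mate_of_le (m + 1) (by omega)
  rw [← h, M.mate_mate] at h2
  omega

theorem insertArc_contract (M : NCMatching (n + 1)) {m : ℕ} (hm : m ≤ 2 * n)
    (h : M.mate m = m + 1) : insertArc m hm (contract m hm M) = M := by
  ext k
  rw [insertArc_contract_mate]
  have h1 := M.mate_mate k
  have h2 := M.mate_mate m
  rcases capArc_spec M.mate m (m + 1) k with h | h | h | h | h <;> grind

/-- Pigeonhole: if no short arc starts at or after `n`, the `n + 2` positions from `n` to `2 * n +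
1` are all matched with the `n` positions below `n`. For `m = n` the arc is the rightmost vertical
line; for `m > n` it is a bracket on the bottom segment. -/
theorem exists_mate_eq_succ (M : NCMatching (n + 1)) :
    ∃ m, n ≤ m ∧ M.mate m = m + 1 := by
  by_contra hcon
  have key : ∀ k, n ≤ k → k < 2 * (n + 1) → M.mate k < n := by
    intro k hk hk'
    by_contra h
    have h1 := M.mate_ne k hk'
    rcases lt_or_ge k (M.mate k) with h2 | h2
    · exact hcon (M.exists_innermost k hk h2)
    · exact hcon (M.exists_innermost (M.mate k) (not_lt.1 h) (by rw [M.mate_mate]; omega))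
  have hcard := Finset.card_le_card_of_injOn (s := Finset.Ico n (2 * (n + 1)))
    (t := Finset.range n) M.mate (fun k hk => by
      have := Finset.mem_Ico.1 hk
      exact Finset.mem_coe.2 (Finset.mem_range.2 (key k this.1 this.2)))
    (fun a _ b _ h => by rw [← M.mate_mate a, h, M.mate_mate])
  simp at hcard
  omega

theorem exists_eq_insertArc (M : NCMatching (n + 1)) :
    ∃ (m : ℕ) (hm : m ≤ 2 * n) (A : NCMatching n), n ≤ m ∧ M = insertArc m hm A := by
  obtain ⟨m, hm, h⟩ := M.exists_mate_eq_succ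
  have := M.lt_of_mate_eq_succ h
  exact ⟨m, by omega, contract m (by omega) M, hm, (M.insertArc_contract _ h).symm⟩

end NCMatching

/-! ### Descending products under the Jones relations -/

/-- The elements `t 0, …, t (N - 1)` of a monoid satisfy the relations of the Jones monoid. -/
structure IsJonesFamily {G : Type*} [Monoid G] (t : ℕ → G) (N : ℕ) : Prop where
  mul_self : ∀ i, i < N → t i * t i = t i
  comm : ∀ i j, i + 1 < j → j < N → Commute (t i) (t j)
  mul_succ_mul : ∀ i, i + 1 < N → t i * t (i + 1) * t i = t i
  succ_mul_mul : ∀ i, i + 1 < N → t (i + 1) * t i * t (i + 1) = t (i + 1)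

/-- The product `t (a - 1) * t (a - 2) * … * t b`. -/
def descProd {G : Type*} [Monoid G] (t : ℕ → G) : ℕ → ℕ → G
  | 0, _ => 1
  | a + 1, b => if b ≤ a then t a * descProd t a b else 1

section descProd

variable {G : Type*} [Monoid G] {t : ℕ → G} {N : ℕ}

theorem descProd_of_le {a b : ℕ} (h : a ≤ b) : descProd t a b = 1 := by
  cases a with
  | zero => rfl
  | succ a => exact if_neg (by omega)

theorem descProd_succ_left {a b : ℕ} (h : b ≤ a) :
    descProd t (a + 1) b = t a * descProd t a b := if_pos h

theorem descProd_succ_self (a : ℕ) : descProd t (a + 1) a = t a := by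
  rw [descProd_succ_left le_rfl, descProd_of_le le_rfl, mul_one]

theorem descProd_mul {a b c : ℕ} (hcb : c ≤ b) (hba : b ≤ a) :
    descProd t a b * descProd t b c = descProd t a c := by
  induction a, hba using Nat.le_induction with
  | base => rw [descProd_of_le le_rfl, one_mul]
  | succ a ha ih => rw [descProd_succ_left ha, descProd_succ_left (hcb.trans ha), mul_assoc, ih]

theorem descProd_succ_right {a b : ℕ} (h : b < a) :
    descProd t a b = descProd t a (b + 1) * t b := by
  rw [← descProd_mul (Nat.le_succ b) h, descProd_succ_self]

namespace IsJonesFamily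

theorem commute_descProd (ht : IsJonesFamily t N) {i a b : ℕ} (hi : i + 1 < b) (ha : a ≤ N) :
    Commute (t i) (descProd t a b) := by
  induction a with
  | zero => exact Commute.one_right _
  | succ a ih =>
    by_cases h : b ≤ a
    · rw [descProd_succ_left h]
      exact (ht.comm i a (by omega) (by omega)).mul_right (ih (by omega))
    · rw [descProd_of_le (by omega)]
      exact Commute.one_right _

theorem descProd_commute_descProd (ht : IsJonesFamily t N) {a b c e : ℕ} (hc : c < b)
    (ha : a ≤ N) : Commute (descProd t c e) (descProd t a b) := by
  induction c with
  | zero => exact Commute.one_left _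
  | succ c ih =>
    by_cases h : e ≤ c
    · rw [descProd_succ_left h]
      exact (ht.commute_descProd (by omega) ha).mul_left (ih (by omega))
    · rw [descProd_of_le (by omega)]
      exact Commute.one_left _

/-- The last letter `t b` of the first factor commutes past `t n, …, t (b + 2)` and is absorbed by
`t b * t (b + 1) * t b = t b`. This is the algebraic counterpart of removing two disjoint short arcs
in either order. -/
theorem descProd_mul_descProd (ht : IsJonesFamily t N) {n b c : ℕ} (hc : c ≤ b) (hb : b + 1 ≤ n)
    (hn : n + 1 ≤ N) :
    descProd t n b * descProd t (n + 1) c = descProd t n c * descProd t (n + 1) (b + 2) := by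
  have h1 : descProd t (n + 1) c =
      descProd t (n + 1) (b + 2) * (t (b + 1) * (t b * descProd t b c)) := by
    rw [← descProd_mul (show c ≤ b + 2 by omega) (show b + 2 ≤ n + 1 by omega),
      descProd_succ_left (show c ≤ b + 1 by omega), descProd_succ_left hc]
  have h2 : descProd t n b = descProd t n (b + 1) * t b := descProd_succ_right hb
  calc _ = descProd t n (b + 1) * ((t b * descProd t (n + 1) (b + 2)) *
        (t (b + 1) * (t b * descProd t b c))) := by rw [h1, h2]; simp only [mul_assoc]
    _ = descProd t n (b + 1) * (descProd t (n + 1) (b + 2) *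
        (t b * t (b + 1) * t b * descProd t b c)) := by
      rw [(ht.commute_descProd (by omega) hn).eq]; simp only [mul_assoc]
    _ = descProd t n (b + 1) * (descProd t (b + 1) c * descProd t (n + 1) (b + 2)) := by
      rw [ht.mul_succ_mul b (by omega), ← descProd_succ_left hc,
        (ht.descProd_commute_descProd (by omega) hn).eq]
    _ = _ := by rw [← mul_assoc, descProd_mul (by omega) hb]

end IsJonesFamily

end descProd

/-! ### The normal form of a matching as a word in the tangles -/

namespace NCMatching

variable {n : ℕ}

/-- The normal form of a matching of `n` top and `n` bottom positions, as a product of elements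
`t 0, …, t (n - 2)` of a monoid. -/
noncomputable def toProd {G : Type*} [Monoid G] (t : ℕ → G) : (n : ℕ) → NCMatching n → G
  | 0, _ => 1
  | n + 1, M =>
    have h := M.lt_of_mate_eq_succ M.exists_mate_eq_succ.choose_spec.2
    toProd t n (contract M.exists_mate_eq_succ.choose (by omega) M) *
      descProd t n (2 * n - M.exists_mate_eq_succ.choose)

variable {G : Type*} [Monoid G] {t : ℕ → G} {N : ℕ}

theorem exists_toProd_eq (t : ℕ → G) (M : NCMatching (n + 1)) :
    ∃ (m : ℕ) (hm : m ≤ 2 * n) (A : NCMatching n), n ≤ m ∧ M = insertArc m hm A ∧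
      toProd t (n + 1) M = toProd t n A * descProd t n (2 * n - m) := by
  have h := M.exists_mate_eq_succ.choose_spec
  have h' := M.lt_of_mate_eq_succ h.2
  exact ⟨M.exists_mate_eq_succ.choose, by omega, _, h.1, (M.insertArc_contract _ h.2).symm, rfl⟩

theorem insertArc_injective {m : ℕ} {hm : m ≤ 2 * n} {A B : NCMatching n}
    (h : insertArc m hm A = insertArc m hm B) : A = B := by
  rw [← contract_insertArc m hm A, h, contract_insertArc]

theorem insertArc_ne_insertArc_succ {m : ℕ} {hm : m ≤ 2 * n} {hm' : m + 1 ≤ 2 * n}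
    {A B : NCMatching n} : insertArc m hm A ≠ insertArc (m + 1) hm' B := by
  intro h
  have h1 := insertArc_mate_succ m hm A
  rw [h, insertArc_mate_self] at h1
  omega

/-- A matching with two disjoint short arcs comes from one matching `E` with both removed, a diamond
on which the independence of the choice in `toProd` rests. -/
theorem exists_eq_of_insertArc_eq {m l : ℕ} (hml : m ≤ l) (hl : l ≤ 2 * n)
    {A B : NCMatching (n + 1)}
    (h : insertArc m (by omega) A = insertArc (l + 2) (by omega) B) :
    ∃ E : NCMatching n, A = insertArc l hl E ∧ B = insertArc m (hml.trans hl) E := by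
  have hA : A = insertArc l hl (contract m (hml.trans hl) B) := by
    rw [← contract_insertArc_of_ge m l hml hl, ← h, contract_insertArc]
  refine ⟨_, hA, ?_⟩
  conv_lhs => rw [← contract_insertArc (l + 2) (by omega) B, ← h,
    contract_insertArc_of_le m l hml hl, hA, contract_insertArc]

/-- The chosen short arc in the definition of `toProd` may be replaced by any other one. Two
different short arcs share no position, so removing both and using the induction hypothesis twice
reduces the claim to `descProd_mul_descProd`. -/
theorem toProd_insertArc (ht : IsJonesFamily t N) (hn : n ≤ N) {m : ℕ} (hm : m ≤ 2 * n)
    (hnm : n ≤ m) (A : NCMatching n) :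
    toProd t (n + 1) (insertArc m hm A) = toProd t n A * descProd t n (2 * n - m) := by
  induction n generalizing m with
  | zero =>
    obtain ⟨l, hl, B, -, h1, h2⟩ := exists_toProd_eq t (insertArc m hm A)
    obtain rfl : l = m := by omega
    rw [h2, insertArc_injective h1]
  | succ n ih =>
    have key : ∀ {m l : ℕ} (hm : m ≤ 2 * (n + 1)) (hl : l ≤ 2 * (n + 1)) (A B : NCMatching (n + 1)),
        n + 1 ≤ m → m ≤ l → insertArc m hm A = insertArc l hl B →
        toProd t (n + 1) A * descProd t (n + 1) (2 * (n + 1) - m) =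
        toProd t (n + 1) B * descProd t (n + 1) (2 * (n + 1) - l) := by
      intro m l hm hl A B hnm hml h
      rcases hml.eq_or_lt with rfl | hml'
      · rw [insertArc_injective h]
      · rcases Nat.eq_or_lt_of_le (Nat.succ_le_of_lt hml') with rfl | hml''
        · exact absurd h insertArc_ne_insertArc_succ
        · obtain ⟨l, rfl⟩ : ∃ l', l = l' + 2 := ⟨l - 2, by omega⟩
          obtain ⟨E, rfl, rfl⟩ := exists_eq_of_insertArc_eq (by omega) (by omega) h
          rw [ih (by omega) (by omega) (by omega), ih (by omega) (by omega) (by omega),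
            mul_assoc, mul_assoc]
          have := ht.descProd_mul_descProd (n := n) (b := 2 * n - m) (c := 2 * n - l)
            (by omega) (by omega) (by omega)
          rw [show 2 * (n + 1) - m = 2 * n - m + 2 by omega,
            show 2 * (n + 1) - (l + 2) = 2 * n - l by omega, this]
    obtain ⟨l, hl, B, hnl, h1, h2⟩ := exists_toProd_eq t (insertArc m hm A)
    rw [h2]
    rcases le_total m l with h | h
    · exact (key hm hl A B hnm h h1).symm
    · exact key hl hm B A hnl h h1.symm

/-- The short arc `l` removed from `M` is compared with the bracket at `m`. If `l + 1 = m`, the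
letter extends the descending product; if `l = m`, it is absorbed by idempotence; if `l = m + 1`, a
zigzag relation removes it. Otherwise the two sites are disjoint, and the letter moves through the
product so that the induction hypothesis applies to `A`. -/
theorem toProd_mul (ht : IsJonesFamily t N) (hn : n ≤ N) {m : ℕ} (hm : m ≤ 2 * n)
    (hnm : n < m) (M : NCMatching (n + 1)) :
    toProd t (n + 1) M * t (2 * n - m) =
      toProd t n (contract m hm M) * descProd t n (2 * n - m) := by
  induction n generalizing m with
  | zero => omega
  | succ n ih =>
    obtain ⟨l, hl, A, hnl, rfl⟩ := M.exists_eq_insertArc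
    rw [toProd_insertArc ht hn hl hnl, mul_assoc]
    obtain ⟨i, hi⟩ : ∃ i, 2 * (n + 1) - m = i := ⟨_, rfl⟩
    rw [hi]
    rcases lt_trichotomy l m with h | rfl | h
    · obtain rfl | h' : m = l + 1 ∨ l + 2 ≤ m := by omega
      · rw [contract_succ_insertArc, show 2 * (n + 1) - l = i + 1 by omega,
          ← descProd_succ_right (by omega)]
      · obtain ⟨m, rfl⟩ : ∃ m', m = m' + 2 := ⟨m - 2, by omega⟩
        rw [contract_insertArc_of_le l m (by omega) (by omega), toProd_insertArc ht (by omega)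
          _ (by omega), ← (ht.commute_descProd (by omega) hn).eq, ← mul_assoc,
          show i = 2 * n - m by omega, ih (by omega) (by omega) (by omega), mul_assoc, mul_assoc]
        have := ht.descProd_mul_descProd (n := n) (b := 2 * n - l) (c := 2 * n - m)
            (by omega) (by omega) (by omega)
        rw [this, show 2 * n - l + 2 = 2 * (n + 1) - l by omega]
    · rw [contract_insertArc, hi, descProd_succ_right (by omega), mul_assoc,
        ht.mul_self i (by omega)]
    · obtain rfl | h' : l = m + 1 ∨ m + 2 ≤ l := by omega
      · obtain ⟨j, rfl⟩ : ∃ j, i = j + 1 := ⟨i - 1, by omega⟩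
        rw [contract_insertArc_succ, show 2 * (n + 1) - (m + 1) = j by omega,
          ← descProd_mul (show j ≤ j + 2 by omega) (show j + 2 ≤ n + 1 by omega),
          descProd_succ_left (show j ≤ j + 1 by omega), descProd_succ_self,
          descProd_succ_right (show j + 1 < n + 1 by omega), mul_assoc, ht.succ_mul_mul j (by omega)]
      · obtain ⟨l, rfl⟩ : ∃ l', l = l' + 2 := ⟨l - 2, by omega⟩
        obtain ⟨j, rfl⟩ : ∃ j, i = j + 2 := ⟨i - 2, by omega⟩
        rw [contract_insertArc_of_ge m l (by omega) (by omega), toProd_insertArc ht (by omega)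
          _ (by omega), mul_assoc]
        obtain ⟨e, he⟩ : ∃ e, 2 * n - l = e := ⟨_, rfl⟩
        rw [show 2 * (n + 1) - (l + 2) = e by omega, he]
        have hR := ih (show n ≤ N by omega) (m := m) (by omega) (by omega) A
        rw [show 2 * n - m = j by omega] at hR
        -- The letter `t (j + 2)` commutes back to `t (j + 2) * t (j + 1)`, where the zigzag
        -- relation deletes it together with `t (j + 1)`. The product thus breaks into two commuting
        -- pieces, and the first letter `t j` of the lower one is where the induction hypothesis is
        -- used: the bracket site is lower by two in `A`.
        have h2 : descProd t (n + 1) e * t (j + 2) =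
            t j * descProd t j e * descProd t (n + 1) (j + 2) := by
          have hc : Commute (descProd t (j + 1) e) (t (j + 2)) := by
            rw [← descProd_succ_self (t := t) (j + 2)]
            exact ht.descProd_commute_descProd (by omega) (by omega)
          rw [← descProd_mul (show e ≤ j + 2 by omega) (show j + 2 ≤ n + 1 by omega),
            descProd_succ_left (show e ≤ j + 1 by omega), mul_assoc, mul_assoc, hc.eq,
            descProd_succ_right (show j + 2 < n + 1 by omega), ← mul_assoc (t (j + 1)),
            mul_assoc, ← mul_assoc (t (j + 2)), ← mul_assoc (t (j + 2)),
            ht.succ_mul_mul (j + 1) (by omega), ← mul_assoc,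
            ← descProd_succ_right (show j + 2 < n + 1 by omega),
            ← descProd_succ_left (show e ≤ j by omega)]
          exact (ht.descProd_commute_descProd (by omega) hn).eq.symm
        rw [h2, ← mul_assoc, ← mul_assoc, hR, mul_assoc (toProd t n _),
          descProd_mul (by omega) (by omega), mul_assoc]

/-- The matching of `n` top and `n` bottom positions in which all arcs are vertical. -/
def vertical (n : ℕ) : NCMatching n where
  mate k := if k < 2 * n then 2 * n - 1 - k else k
  mate_mate k := by split_ifs <;> omega
  mate_ne k hk := by split_ifs; omega
  mate_of_le k hk := by split_ifs <;> omega
  noncrossing a k := by split_ifs <;> omega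

theorem insertArc_vertical (n : ℕ) : insertArc n (by omega) (vertical n) = vertical (n + 1) := by
  ext k
  rcases eq_or_exists_shiftUp n k with rfl | rfl | ⟨k, rfl⟩
  · rw [insertArc_mate_self]
    simp only [vertical]
    split_ifs <;> omega
  · rw [insertArc_mate_succ]
    simp only [vertical]
    split_ifs <;> omega
  · rw [insertArc_mate_shiftUp]
    simp only [vertical, shiftUp]
    split_ifs <;> omega

theorem toProd_vertical (ht : IsJonesFamily t N) (hn : n ≤ N + 1) :
    toProd t n (vertical n) = 1 := by
  induction n with
  | zero => rfl
  | succ n ih =>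
    rw [← insertArc_vertical, toProd_insertArc ht (by omega) _ le_rfl, ih (by omega),
      descProd_of_le (by omega), one_mul]

theorem toProd_insertArc_contract (ht : IsJonesFamily t N) (hn : n ≤ N) {m : ℕ} (hm : m ≤ 2 * n)
    (hnm : n < m) (M : NCMatching (n + 1)) :
    toProd t (n + 1) (insertArc m hm (contract m hm M)) =
      toProd t (n + 1) M * t (2 * n - m) := by
  rw [toProd_insertArc ht hn hm hnm.le, toProd_mul ht hn hm hnm]

/-- The matchings that are obtained from the vertical one by adding arcs at the bottom. -/
inductive Reachable : (n : ℕ) → NCMatching n → Prop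
  | vertical (n : ℕ) : Reachable n (vertical n)
  | step (n m : ℕ) (hm : m ≤ 2 * n) (hnm : n < m) (M : NCMatching (n + 1)) :
      Reachable (n + 1) M → Reachable (n + 1) (insertArc m hm (contract m hm M))

/-- Inserting at `n` adds a vertical line on the right, under which a construction for `n` strands
remains valid: each bracket position `m` becomes `m + 2`. -/
theorem Reachable.insertArc_self {M : NCMatching n} (h : Reachable n M) :
    Reachable (n + 1) (insertArc n (by omega) M) := by
  induction h with
  | vertical n =>
    rw [insertArc_vertical]
    exact .vertical _
  | step n m hm hnm M _ ih =>
    rw [← insertArc_insertArc (n + 1) m (by omega) hm,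
      ← contract_insertArc_of_le (n + 1) m (by omega) hm]
    exact .step _ _ (by omega) (by omega) _ ih

/-- Starting from the vertical line on the right, each further tangle moves the short arc one place
along the bottom segment, since contracting at `m + 1` undoes the insertion at `m`. -/
theorem Reachable.insertArc {M : NCMatching n} (h : Reachable n M) {m : ℕ} (hm : m ≤ 2 * n)
    (hnm : n ≤ m) : Reachable (n + 1) (insertArc m hm M) := by
  induction m, hnm using Nat.le_induction with
  | base => exact h.insertArc_self
  | succ m hnm ih =>
    have := Reachable.step n (m + 1) hm (by omega) _ (ih (by omega))
    rwa [contract_succ_insertArc] at this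

theorem reachable (M : NCMatching n) : Reachable n M := by
  induction n with
  | zero =>
    obtain rfl : M = NCMatching.vertical 0 := by
      ext k
      rw [M.mate_of_le k (by omega), (NCMatching.vertical 0).mate_of_le k (by omega)]
    exact .vertical 0
  | succ n ih =>
    obtain ⟨m, hm, A, hnm, rfl⟩ := M.exists_eq_insertArc
    exact (ih A).insertArc hm hnm

end NCMatching

/-! ### Counting matchings by Dyck words -/

/-- A list of steps with as many up steps as down steps, which stays above its start. -/
def IsBalanced (l : List DyckStep) : Prop :=
  l.count .U = l.count .D ∧ ∀ l' l'', l = l' ++ l'' → l'.count .D ≤ l'.count .U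

theorem isBalanced_insert_iff (a b : List DyckStep) :
    IsBalanced (a ++ .U :: .D :: b) ↔ IsBalanced (a ++ b) := by
  unfold IsBalanced
  refine and_congr (by simp; omega) ⟨fun h l' l'' e ↦ ?_, fun h l' l'' e ↦ ?_⟩
  · rcases List.append_eq_append_iff.1 e with ⟨c, rfl, rfl⟩ | ⟨c, rfl, rfl⟩
    · have := h (a ++ .U :: .D :: c) l'' (by simp)
      simp at this ⊢
      omega
    · exact h l' (c ++ .U :: .D :: b) (by simp)
  · rcases List.append_eq_append_iff.1 e with ⟨c, rfl, hc⟩ | ⟨c, rfl, rfl⟩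
    · rcases c with - | ⟨x, - | ⟨y, c⟩⟩
      · simpa using h a b rfl
      · obtain ⟨rfl, rfl⟩ : DyckStep.U = x ∧ _ := by simpa using hc
        have := h a b rfl
        simp
        omega
      · obtain ⟨rfl, rfl, rfl⟩ : DyckStep.U = x ∧ DyckStep.D = y ∧ b = c ++ l'' := by
          simpa using hc
        have := h (a ++ c) l'' (by simp)
        simp at this ⊢
        omega
    · exact h l' (c ++ b) (by simp)

theorem IsBalanced.exists_peak {l : List DyckStep} (h : IsBalanced l) (hl : l ≠ []) :
    ∃ a b, l = a ++ .U :: .D :: b := by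
  have key : ∀ l : List DyckStep, .D ∈ l → ∃ a b, .U :: l = a ++ .U :: .D :: b := by
    intro l
    induction l with
    | nil => simp
    | cons x l ih =>
      intro hx
      cases x with
      | D => exact ⟨[], l, rfl⟩
      | U =>
        obtain ⟨a, b, hab⟩ := ih (by simpa using hx)
        exact ⟨.U :: a, b, by rw [hab]; rfl⟩
  cases l with
  | nil => exact absurd rfl hl
  | cons x l =>
    cases x with
    | D => simpa using h.2 [.D] l rfl
    | U =>
      refine key l ?_
      have := h.1
      simp only [List.count_cons] at this
      exact List.count_pos_iff.1 (by simp at this; omega)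

namespace NCMatching

variable {n : ℕ}

/-- The Dyck word of a matching: the left ends of arcs are up steps, the right ends are down
steps. -/
def steps (M : NCMatching n) : List DyckStep :=
  (List.range (2 * n)).map fun k ↦ if k < M.mate k then .U else .D

theorem lt_mate_iff_of_steps_eq {M M' : NCMatching n} (h : M.steps = M'.steps) (k : ℕ) :
    k < M.mate k ↔ k < M'.mate k := by
  by_cases hk : k < 2 * n
  · have := List.map_inj_left.1 h k (List.mem_range.2 hk)
    split_ifs at this <;> tauto
  · rw [M.mate_of_le k (by omega), M'.mate_of_le k (by omega)]

/-- At a short arc of `M`, the position `m` opens and `m + 1` closes in `M'` too. A longer arc of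
`M'` from `m` would have to contain the partner of `m + 1`, so `M'` has the same short arc, which is
removed from both. -/
theorem eq_of_forall_lt_mate_iff {M M' : NCMatching n} (h : ∀ k, k < M.mate k ↔ k < M'.mate k) :
    M = M' := by
  induction n with
  | zero =>
    ext k
    rw [M.mate_of_le k (by omega), M'.mate_of_le k (by omega)]
  | succ n ih =>
    obtain ⟨m, hm, A, -, rfl⟩ := M.exists_eq_insertArc
    have h0 := h m
    have h1 := h (m + 1)
    rw [insertArc_mate_self] at h0
    rw [insertArc_mate_succ] at h1
    have h2 := M'.mate_succ_ne_of_le hm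
    have h3 := M'.noncrossing m (m + 1)
    rw [← M'.insertArc_contract hm (by omega)]
    congr 1
    refine ih fun k ↦ ?_
    have h4 := h (shiftUp m k)
    rwa [← M'.insertArc_contract hm (by omega), insertArc_mate_shiftUp, insertArc_mate_shiftUp,
      shiftUp_lt_iff, shiftUp_lt_iff] at h4

theorem steps_injective : Function.Injective (steps (n := n)) :=
  fun _ _ h ↦ eq_of_forall_lt_mate_iff (lt_mate_iff_of_steps_eq h)

theorem steps_insertArc {m : ℕ} (hm : m ≤ 2 * n) (M : NCMatching n) {a b : List DyckStep}
    (h : M.steps = a ++ b) (ha : a.length = m) :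
    (insertArc m hm M).steps = a ++ .U :: .D :: b := by
  have hlen : a.length + b.length = 2 * n := by
    rw [← List.length_append, ← h]
    simp [steps]
  have hget : ∀ k (hk : k < (a ++ b).length), (a ++ b)[k] = if k < M.mate k then .U else .D := by
    intro k hk
    simp only [← h, steps, List.getElem_map, List.getElem_range]
  refine List.ext_getElem (by simp [steps]; omega) fun i h1 h2 ↦ ?_
  simp only [steps, List.getElem_map, List.getElem_range]
  simp only [List.length_append, List.length_cons] at h2
  rcases eq_or_exists_shiftUp m i with rfl | rfl | ⟨k, rfl⟩
  · simp [← ha]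
  · simp [← ha]
  · rw [insertArc_mate_shiftUp]
    simp only [shiftUp_lt_iff]
    by_cases hk : k < m
    · simp only [shiftUp_of_lt hk]
      rw [← hget k (by simp; omega)]
      simp [show k < a.length by omega]
    · simp only [shiftUp_of_le (not_lt.1 hk)] at h2 ⊢
      rw [← hget k (by simp; omega)]
      simp [List.getElem_append, show ¬ k < a.length by omega,
        show ¬ k + 2 < a.length by omega, show k + 2 - a.length = k - a.length + 2 by omega]

theorem isBalanced_steps (M : NCMatching n) : IsBalanced M.steps := by
  induction n with
  | zero => simp [steps, IsBalanced]
  | succ n ih =>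
    obtain ⟨m, hm, A, -, rfl⟩ := M.exists_eq_insertArc
    rw [steps_insertArc hm A (List.take_append_drop m A.steps).symm (by simp [steps, hm]),
      isBalanced_insert_iff, List.take_append_drop]
    exact ih A

theorem exists_steps_eq {l : List DyckStep} (hl : IsBalanced l) (hn : l.length = 2 * n) :
    ∃ M : NCMatching n, M.steps = l := by
  induction n generalizing l with
  | zero =>
    obtain rfl : l = [] := List.eq_nil_of_length_eq_zero hn
    exact ⟨vertical 0, rfl⟩
  | succ n ih =>
    obtain ⟨a, b, rfl⟩ := hl.exists_peak (by rintro rfl; simp at hn)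
    simp only [List.length_append, List.length_cons] at hn
    obtain ⟨A, hA⟩ := ih ((isBalanced_insert_iff a b).1 hl) (by simp; omega)
    exact ⟨_, steps_insertArc (by omega) A hA rfl⟩

/-- The Dyck word of a matching. -/
def toDyckWord (M : NCMatching n) : {p : DyckWord // p.semilength = n} :=
  ⟨⟨M.steps, M.isBalanced_steps.1, fun i ↦
    M.isBalanced_steps.2 _ (M.steps.drop i) (List.take_append_drop i _).symm⟩, by
    have h := DyckWord.two_mul_semilength_eq_length (p := ⟨M.steps, M.isBalanced_steps.1, fun i ↦
      M.isBalanced_steps.2 _ (M.steps.drop i) (List.take_append_drop i _).symm⟩)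
    simp only [steps, List.length_map, List.length_range] at h
    exact Nat.eq_of_mul_eq_mul_left two_pos h⟩

theorem bijective_toDyckWord : Function.Bijective (toDyckWord (n := n)) := by
  refine ⟨fun M M' h ↦ steps_injective (congrArg (fun p ↦ p.1.toList) h), fun ⟨p, hp⟩ ↦ ?_⟩
  obtain ⟨M, hM⟩ := exists_steps_eq (n := n) (l := p.toList)
    ⟨p.count_U_eq_count_D, fun l' l'' h ↦ by simpa [h] using p.count_D_le_count_U l'.length⟩
    (by rw [← p.two_mul_semilength_eq_length, hp])
  exact ⟨M, Subtype.ext (DyckWord.ext hM)⟩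

instance : Finite (NCMatching n) := Finite.of_injective _ bijective_toDyckWord.1

theorem card_eq_catalan (n : ℕ) : Nat.card (NCMatching n) = catalan n := by
  rw [Nat.card_congr (Equiv.ofBijective _ bijective_toDyckWord), Nat.card_eq_fintype_card,
    DyckWord.card_dyckWord_semilength_eq_catalan]

/-- The left ends of the arcs of a matching. -/
abbrev LeftEnd (M : NCMatching n) : Type := {k : Fin (2 * n) // k.1 < M.mate k.1}

/-- The matching exchanges left ends and right ends, so each kind is half of the `2 * n` positions.
-/
theorem card_leftEnd (M : NCMatching n) : Fintype.card M.LeftEnd = n := by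
  have h1 : Fintype.card {k : Fin (2 * n) // ¬ k.1 < M.mate k.1} = Fintype.card M.LeftEnd := by
    refine Fintype.card_congr
      { toFun := fun k ↦ ⟨⟨M.mate k.1, M.mate_lt k.1.2⟩, ?_⟩
        invFun := fun k ↦ ⟨⟨M.mate k.1, M.mate_lt k.1.2⟩, ?_⟩
        left_inv := fun k ↦ by ext; exact M.mate_mate _
        right_inv := fun k ↦ by ext; exact M.mate_mate _ }
    · have := k.2
      have := M.mate_ne _ k.1.2
      simp only [M.mate_mate]
      omega
    · have := k.2
      simp only [M.mate_mate]
      omega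
  have h2 := Fintype.card_subtype_compl fun k : Fin (2 * n) ↦ k.1 < M.mate k.1
  rw [Fintype.card_fin] at h2
  have h3 := Fintype.card_subtype_le fun k : Fin (2 * n) ↦ k.1 < M.mate k.1
  rw [Fintype.card_fin] at h3
  change _ = 2 * n - Fintype.card M.LeftEnd at h2
  change Fintype.card M.LeftEnd ≤ 2 * n at h3
  omega

end NCMatching

/-! ### Reconnection of arcs that carry beads -/

section capBeads

variable {α : Type*} [DecidableEq α] {R : Type*} [CommRing R]

/-- The bead numbers after the arcs were changed to `capArc f p q`. -/
def capBeads (f : α → α) (b : α → R) (p q x : α) : R :=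
  if x = p ∨ x = q then 0
  else if f x = p then b x + b q else if f x = q then b x + b p else b x

theorem capBeads_left (f : α → α) (b : α → R) (p q : α) : capBeads f b p q p = 0 :=
  if_pos (.inl rfl)

theorem capBeads_right (f : α → α) (b : α → R) (p q : α) : capBeads f b p q q = 0 :=
  if_pos (.inr rfl)

theorem capArc_comm {f : α → α} (hf : ∀ x, f (f x) = x) (p q x : α) :
    capArc f p q x = capArc f q p x := by
  have h := hf x
  unfold capArc
  grind

theorem capBeads_comm {f : α → α} (hf : ∀ x, f (f x) = x) (b : α → R) (p q x : α) :
    capBeads f b p q x = capBeads f b q p x := by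
  have h := hf x
  unfold capBeads
  grind

theorem capBeads_capArc {f : α → α} (hf : ∀ x, f (f x) = x) {b : α → R}
    (hb : ∀ x, b (f x) = b x) {p q : α} (hp : f p ≠ p) (hq : f q ≠ q) (x : α) :
    capBeads f b p q (capArc f p q x) = capBeads f b p q x := by
  have h1 := hf x
  have h2 := hf p
  have h3 := hf q
  have h4 := hb x
  have h5 := hb p
  have h6 := hb q
  rcases capArc_spec f p q x with h | h | h | h | h
  · rw [h.2, h.1, capBeads_left, capBeads_right]
  · rw [h.2.2, h.2.1, capBeads_left, capBeads_right]
  · rw [h.2.2.2]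
    unfold capBeads
    grind
  · rw [h.2.2.2.2]
    unfold capBeads
    grind
  · rw [h.2.2.2.2]
    unfold capBeads
    grind

theorem capArc_of_apply_eq {f : α → α} (hf : ∀ x, f (f x) = x) {p q : α} (h : f p = q) (x : α) :
    capArc f p q x = f x := by
  have h1 := hf x
  have h2 := hf p
  unfold capArc
  grind

theorem capBeads_of_apply_eq {f : α → α} (hf : ∀ x, f (f x) = x) (b : α → R) {p q : α}
    (h : f p = q) (x : α) : capBeads f b p q x = if x = p ∨ x = q then 0 else b x := by
  have h1 := hf x
  have h2 := hf p
  unfold capBeads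
  grind

/-- When `p` and `q` are joined by a bracket, reconnecting at `r, p` moves the old arc of `r` over
to `q`, and reconnecting at `p, q` brings it back to `r`. This is the pairing behind `t_i * t_j *
t_i = t_i`. -/
theorem capArc_zigzag {f : α → α} (hf : ∀ x, f (f x) = x) (hne : ∀ x, f x ≠ x) {p q r : α} (h : f p = q) (hr : r ≠ p)
    (hr' : r ≠ q) (x : α) : capArc (capArc f r p) p q x = f x := by
  have h1 := hf x
  have h2 := hf p
  have h3 := hf r
  have h0 := hne p
  have h4 : capArc f r p p = r := capArc_right _ _ _
  have h5 : capArc f r p q = f r := by unfold capArc; grind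
  have h6 := capArc_spec f r p x
  have h7 := capArc_spec (capArc f r p) p q x
  rw [h4, h5] at h7
  -- With the values of `capArc` replaced by variables, the specifications leave a finite case check
  -- on equalities between points.
  generalize capArc (capArc f r p) p q x = y at *
  generalize capArc f r p x = z at *
  grind

theorem capBeads_spec (f : α → α) (b : α → R) (p q x : α) :
    (x = p ∧ capBeads f b p q x = 0) ∨ (x = q ∧ capBeads f b p q x = 0) ∨
    (x ≠ p ∧ x ≠ q ∧ f x = p ∧ capBeads f b p q x = b x + b q) ∨
    (x ≠ p ∧ x ≠ q ∧ f x ≠ p ∧ f x = q ∧ capBeads f b p q x = b x + b p) ∨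
    (x ≠ p ∧ x ≠ q ∧ f x ≠ p ∧ f x ≠ q ∧ capBeads f b p q x = b x) := by
  unfold capBeads
  split_ifs <;> tauto

theorem capBeads_zigzag {f : α → α} (hf : ∀ x, f (f x) = x) (hne : ∀ x, f x ≠ x) {b : α → R}
    (hb : ∀ x, b (f x) = b x) {p q r : α} (h : f p = q) (hr : r ≠ p)
    (hr' : r ≠ q) (h0 : b p = 0) (x : α) :
    capBeads (capArc f r p) (capBeads f b r p) p q x = b x := by
  have h1 := hf x
  have h2 := hf p
  have h3 := hf r
  have b1 := hb p
  have b2 := hb r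
  have h4 := hne p
  have e1 : capBeads f b r p p = 0 := capBeads_right _ _ _ _
  have e2 : capBeads f b r p q = b r := by
    have h5 : b q = 0 := by rw [← h, b1, h0]
    unfold capBeads
    rw [if_neg (by grind), if_neg (by grind), if_pos (by grind), h5, zero_add]
  have b3 := hb x
  have a1 : ∀ y : R, y + 0 = y := add_zero
  have a2 : ∀ y : R, 0 + y = y := zero_add
  have h6 := capArc_spec f r p x
  have h7 := capBeads_spec f b r p x
  have h8 := capBeads_spec (capArc f r p) (capBeads f b r p) p q x
  rw [e1, e2] at h8
  generalize capBeads (capArc f r p) (capBeads f b r p) p q x = y at *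
  generalize capArc f r p x = z at *
  generalize capBeads f b r p x = w at *
  rcases h8 with h8 | h8 | h8 | h8 | h8 <;> rcases h6 with h6 | h6 | h6 | h6 | h6 <;> grind

theorem capArc_capArc_comm {f : α → α} (hf : ∀ x, f (f x) = x) (hne : ∀ x, f x ≠ x) {p q r s : α}
    (hpq : p ≠ q) (hrs : r ≠ s) (hpr : p ≠ r) (hps : p ≠ s) (hqr : q ≠ r) (hqs : q ≠ s) (x : α) :
    capArc (capArc f p q) r s x = capArc (capArc f r s) p q x := by
  have i : ∀ x y, f x = y → f y = x := by rintro x _ rfl; exact hf x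
  have gr := capArc_spec f p q r
  have gs := capArc_spec f p q s
  have gx := capArc_spec f p q x
  have kp := capArc_spec f r s p
  have kq := capArc_spec f r s q
  have kx := capArc_spec f r s x
  have o1 := capArc_spec (capArc f p q) r s x
  have o2 := capArc_spec (capArc f r s) p q x
  generalize capArc (capArc f p q) r s x = y at *
  generalize capArc (capArc f r s) p q x = y' at *
  generalize capArc f p q r = gr' at *
  generalize capArc f p q s = gs' at *
  generalize capArc f p q x = gx' at *
  generalize capArc f r s p = kp' at *
  generalize capArc f r s q = kq' at *
  generalize capArc f r s x = kx' at *
  have := i x p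
  have := i x q
  have := i x r
  have := i x s
  have := i p r
  have := i p s
  have := i q r
  have := i q s
  have := i p q
  have := i r s
  have := i r p
  have := i r q
  have := i s p
  have := i s q
  have := hne p
  have := hne q
  have := hne r
  have := hne s
  clear i hf hne
  rcases o1 with o1 | o1 | o1 | o1 | o1 <;> rcases o2 with o2 | o2 | o2 | o2 | o2 <;> grind

theorem capBeads_capBeads_comm {f : α → α} (hf : ∀ x, f (f x) = x) (hne : ∀ x, f x ≠ x) {b : α → R}
    (hb : ∀ x, b (f x) = b x) {p q r s : α} (hpq : p ≠ q) (hrs : r ≠ s) (hpr : p ≠ r)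
    (hps : p ≠ s) (hqr : q ≠ r) (hqs : q ≠ s) (x : α) :
    capBeads (capArc f p q) (capBeads f b p q) r s x =
      capBeads (capArc f r s) (capBeads f b r s) p q x := by
  have i : ∀ x y, f x = y → f y = x ∧ b y = b x := by rintro x _ rfl; exact ⟨hf x, hb x⟩
  have gx := capArc_spec f p q x
  have kx := capArc_spec f r s x
  have gr := capBeads_spec f b p q r
  have gs := capBeads_spec f b p q s
  have bx := capBeads_spec f b p q x
  have kp := capBeads_spec f b r s p
  have kq := capBeads_spec f b r s q
  have cx := capBeads_spec f b r s x
  have o1 := capBeads_spec (capArc f p q) (capBeads f b p q) r s x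
  have o2 := capBeads_spec (capArc f r s) (capBeads f b r s) p q x
  generalize capBeads (capArc f p q) (capBeads f b p q) r s x = y at *
  generalize capBeads (capArc f r s) (capBeads f b r s) p q x = y' at *
  generalize capArc f p q x = gx' at *
  generalize capArc f r s x = kx' at *
  generalize capBeads f b p q x = bx' at *
  generalize capBeads f b p q r = gr' at *
  generalize capBeads f b p q s = gs' at *
  generalize capBeads f b r s p = kp' at *
  generalize capBeads f b r s q = kq' at *
  generalize capBeads f b r s x = cx' at *
  have := i x p
  have := i x q
  have := i x r
  have := i x s
  have := i p r
  have := i p s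
  have := i q r
  have := i q s
  have := i p q
  have := i r s
  have := i r p
  have := i r q
  have := i s p
  have := i s q
  have := hne p
  have := hne q
  have := hne r
  have := hne s
  clear i hf hne hb
  rcases o1 with o1 | o1 | o1 | o1 | o1 <;> rcases o2 with o2 | o2 | o2 | o2 | o2 <;> grind

end capBeads

/-! ### The matching of a diagram and the action of the generators -/

theorem boundaryPos_lt {n : ℕ} (p : EndPt n) : boundaryPos p < 2 * n := by
  rcases p with i | i <;> have := i.2 <;> simp only [boundaryPos] <;> omega

theorem boundaryPos_injective (n : ℕ) : Function.Injective (boundaryPos (n := n)) := by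
  rintro (i | i) (j | j) h <;> have := i.2 <;> have := j.2 <;> simp only [boundaryPos] at h
  · rw [Fin.ext h]
  · omega
  · omega
  · rw [Fin.ext (show i.1 = j.1 by omega)]

theorem exists_boundaryPos_eq {n k : ℕ} (hk : k < 2 * n) : ∃ p : EndPt n, boundaryPos p = k := by
  by_cases h : k < n
  · exact ⟨.inl ⟨k, h⟩, rfl⟩
  · exact ⟨.inr ⟨2 * n - 1 - k, by omega⟩, by simp only [boundaryPos]; omega⟩

/-- The endpoints of a diagram, numbered along the boundary of the strip. -/
noncomputable def boundaryEquiv (n : ℕ) : EndPt n ≃ Fin (2 * n) :=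
  Equiv.ofBijective (fun p ↦ ⟨boundaryPos p, boundaryPos_lt p⟩)
    ⟨fun _ _ h ↦ boundaryPos_injective n (congrArg Fin.val h), fun k ↦ by
      obtain ⟨p, hp⟩ := exists_boundaryPos_eq k.2
      exact ⟨p, Fin.ext hp⟩⟩

theorem boundaryEquiv_val {n : ℕ} (p : EndPt n) : (boundaryEquiv n p).1 = boundaryPos p := rfl

theorem boundaryPos_symm {n : ℕ} (k : Fin (2 * n)) :
    boundaryPos ((boundaryEquiv n).symm k) = k.1 := by
  rw [← boundaryEquiv_val, Equiv.apply_symm_apply]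

namespace AbacusDiagram

variable {d n : ℕ}

theorem noncrossing' (D : AbacusDiagram d n) {p q : EndPt n} (h1 : boundaryPos p < boundaryPos q)
    (h2 : boundaryPos q < boundaryPos (D.arc p)) :
    boundaryPos p < boundaryPos (D.arc q) ∧ boundaryPos (D.arc q) < boundaryPos (D.arc p) := by
  have h3 := D.noncrossing p q
  have h4 := D.noncrossing (D.arc q) p
  rw [D.arc_arc] at h4
  have h5 : boundaryPos (D.arc q) ≠ boundaryPos p := fun h ↦ by
    rw [← boundaryPos_injective n h, D.arc_arc] at h2
    omega
  have h6 : boundaryPos (D.arc q) ≠ boundaryPos (D.arc p) := fun h ↦ by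
    have := congrArg D.arc (boundaryPos_injective n h)
    rw [D.arc_arc, D.arc_arc] at this
    rw [this] at h1
    omega
  omega

/-- The pairing of the boundary positions in a diagram. -/
noncomputable def toMatching (D : AbacusDiagram d n) : NCMatching n where
  mate k := if h : k < 2 * n then boundaryPos (D.arc ((boundaryEquiv n).symm ⟨k, h⟩)) else k
  mate_mate k := by
    by_cases h : k < 2 * n
    · obtain ⟨p, rfl⟩ := exists_boundaryPos_eq h
      have h1 : ∀ q : EndPt n, (boundaryEquiv n).symm ⟨boundaryPos q, boundaryPos_lt q⟩ = q :=
        fun q ↦ (boundaryEquiv n).symm_apply_apply q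
      simp only [boundaryPos_lt, dif_pos, h1, D.arc_arc]
    · simp [h]
  mate_ne k hk := by
    obtain ⟨p, rfl⟩ := exists_boundaryPos_eq hk
    have h1 : ∀ q : EndPt n, (boundaryEquiv n).symm ⟨boundaryPos q, boundaryPos_lt q⟩ = q :=
      fun q ↦ (boundaryEquiv n).symm_apply_apply q
    simp only [boundaryPos_lt, dif_pos, h1]
    exact (boundaryPos_injective n).ne (D.arc_ne p)
  mate_of_le k hk := dif_neg (by omega)
  noncrossing a k h1 h2 := by
    by_cases ha : a < 2 * n
    · have hk : k < 2 * n := by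
        rw [dif_pos ha] at h2
        exact h2.trans (boundaryPos_lt _)
      rw [dif_pos ha] at h2 ⊢
      rw [dif_pos hk]
      have h3 := D.noncrossing' (p := (boundaryEquiv n).symm ⟨a, ha⟩)
        (q := (boundaryEquiv n).symm ⟨k, hk⟩)
      simp only [boundaryPos_symm] at h3
      exact h3 h1 h2
    · rw [dif_neg ha] at h2
      omega

theorem toMatching_mate (D : AbacusDiagram d n) (p : EndPt n) :
    D.toMatching.mate (boundaryPos p) = boundaryPos (D.arc p) := by
  have h1 : (boundaryEquiv n).symm ⟨boundaryPos p, boundaryPos_lt p⟩ = p :=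
    (boundaryEquiv n).symm_apply_apply p
  simp only [toMatching, boundaryPos_lt, dif_pos, h1]

theorem toMatching_eq_iff {D E : AbacusDiagram d n} :
    D.toMatching = E.toMatching ↔ D.arc = E.arc := by
  constructor
  · intro h
    ext1 p
    apply boundaryPos_injective n
    rw [← toMatching_mate, h, toMatching_mate]
  · intro h
    ext k
    simp only [toMatching, h]

/-- Put `α p` beads on the arc that ends at `p`, for each endpoint `p`. -/
def addBeads (α : EndPt n → ZMod d) (D : AbacusDiagram d n) : AbacusDiagram d n where
  arc := D.arc
  beads p := D.beads p + (α p + α (D.arc p))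
  arc_arc := D.arc_arc
  arc_ne := D.arc_ne
  noncrossing := D.noncrossing
  beads_arc p := by rw [D.beads_arc, D.arc_arc, add_comm (α p)]

@[simp]
theorem addBeads_arc (α : EndPt n → ZMod d) (D : AbacusDiagram d n) :
    (D.addBeads α).arc = D.arc := rfl

theorem addBeads_beads (α : EndPt n → ZMod d) (D : AbacusDiagram d n) (p : EndPt n) :
    (D.addBeads α).beads p = D.beads p + (α p + α (D.arc p)) := rfl

@[simp]
theorem addBeads_zero (D : AbacusDiagram d n) : D.addBeads 0 = D := by
  ext p
  · rfl
  · simp [addBeads_beads]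

theorem addBeads_addBeads (α β : EndPt n → ZMod d) (D : AbacusDiagram d n) :
    (D.addBeads α).addBeads β = D.addBeads (α + β) := by
  ext p
  · rfl
  · simp only [addBeads_beads, addBeads_arc, Pi.add_apply]
    ring

/-- Beads belong to arcs, so it is irrelevant at which end of an arc they are put. -/
theorem addBeads_single_arc (D : AbacusDiagram d n) (p : EndPt n) (c : ZMod d) :
    D.addBeads (Pi.single (D.arc p) c) = D.addBeads (Pi.single p c) := by
  ext q
  · rfl
  · have h1 : D.arc q = p ↔ q = D.arc p :=
      ⟨fun h ↦ by rw [← h, D.arc_arc], fun h ↦ by rw [h, D.arc_arc]⟩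
    have h2 : D.arc q = D.arc p ↔ q = p :=
      ⟨fun h ↦ by rw [← D.arc_arc q, h, D.arc_arc], fun h ↦ by rw [h]⟩
    simp only [addBeads_beads, Pi.single_apply, h1, h2]
    rw [add_comm (if q = D.arc p then c else 0)]

/-- The bottom point `i + 1`, the left one of the two points at the bracket of a tangle on the
boundary of the strip. -/
abbrev capL (i : Fin (n - 1)) : EndPt n := .inr (rightStrand i)

/-- The bottom point `i`. -/
abbrev capR (i : Fin (n - 1)) : EndPt n := .inr (leftStrand i)

theorem capL_ne_capR (i : Fin (n - 1)) : capL i ≠ capR i :=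
  fun h ↦ leftStrand_ne_rightStrand i (Sum.inr_injective h).symm

theorem boundaryPos_capL (i : Fin (n - 1)) : boundaryPos (capL i) = 2 * (n - 1) - i := by
  have := i.2
  simp only [boundaryPos, rightStrand]
  omega

theorem boundaryPos_capR (i : Fin (n - 1)) : boundaryPos (capR i) = 2 * (n - 1) - i + 1 := by
  have := i.2
  simp only [boundaryPos, leftStrand]
  omega

theorem boundaryPos_capArc (D : AbacusDiagram d n) (i : Fin (n - 1)) (p : EndPt n) :
    boundaryPos (capArc D.arc (capL i) (capR i) p) =
      capArc D.toMatching.mate (2 * (n - 1) - i) (2 * (n - 1) - i + 1) (boundaryPos p) := by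
  rw [← boundaryPos_capR, ← boundaryPos_capL]
  exact (capArc_map (boundaryPos_injective n) D.toMatching_mate _ _ _).symm

/-- Attach a tangle to the bottom of a diagram. -/
def mulTangle (i : Fin (n - 1)) (D : AbacusDiagram d n) : AbacusDiagram d n where
  arc := capArc D.arc (capL i) (capR i)
  beads := capBeads D.arc D.beads (capL i) (capR i)
  arc_arc := capArc_capArc D.arc_arc (D.arc_ne _) (D.arc_ne _)
  arc_ne p := capArc_ne D.arc_arc (capL_ne_capR i) (D.arc_ne p)
  noncrossing p q h := by
    have h1 := capArc_noncrossing D.toMatching.mate_mate D.toMatching.noncrossing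
      (m := 2 * (n - 1) - i) (D.toMatching.mate_ne _ (by have := i.2; omega))
      (boundaryPos p) (boundaryPos q)
    simp only [← boundaryPos_capArc] at h1
    have h2 := h1 h.1 h.2.1
    omega
  beads_arc := capBeads_capArc D.arc_arc D.beads_arc (D.arc_ne _) (D.arc_ne _)

/-- Links the action on diagrams with the step by which `Reachable` and `toProd_insertArc_contract`
are stated. Bottom points are numbered from right to left, so the bracket of `t_i` starts at
position `2 * n - i`. -/
theorem toMatching_mulTangle {n : ℕ} (i : Fin (n + 1 - 1)) (D : AbacusDiagram d (n + 1)) :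
    (mulTangle i D).toMatching = NCMatching.insertArc (2 * n - i) (by omega)
      (NCMatching.contract (2 * n - i) (by omega) D.toMatching) := by
  ext k
  by_cases hk : k < 2 * (n + 1)
  · obtain ⟨p, rfl⟩ := exists_boundaryPos_eq hk
    rw [toMatching_mate, NCMatching.insertArc_contract_mate]
    exact boundaryPos_capArc D i p
  · rw [NCMatching.mate_of_le _ _ (not_lt.1 hk), NCMatching.mate_of_le _ _ (not_lt.1 hk)]

theorem toMatching_idDiagram : (idDiagram d n).toMatching = NCMatching.vertical n := by
  ext k
  by_cases hk : k < 2 * n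
  · obtain ⟨p, rfl⟩ := exists_boundaryPos_eq hk
    rw [toMatching_mate]
    rcases p with p | p <;> have := p.2 <;>
      simp only [idDiagram, Sum.swap_inl, Sum.swap_inr, boundaryPos, NCMatching.vertical] <;>
      split_ifs <;> omega
  · rw [NCMatching.mate_of_le _ _ (not_lt.1 hk), NCMatching.mate_of_le _ _ (not_lt.1 hk)]

@[simp]
theorem toMatching_addBeads (α : EndPt n → ZMod d) (D : AbacusDiagram d n) :
    (D.addBeads α).toMatching = D.toMatching :=
  toMatching_eq_iff.2 rfl

theorem mulTangle_arc (i : Fin (n - 1)) (D : AbacusDiagram d n) (p : EndPt n) :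
    (mulTangle i D).arc p = capArc D.arc (capL i) (capR i) p := rfl

theorem mulTangle_beads (i : Fin (n - 1)) (D : AbacusDiagram d n) (p : EndPt n) :
    (mulTangle i D).beads p = capBeads D.arc D.beads (capL i) (capR i) p := rfl

theorem mulTangle_arc_capL (i : Fin (n - 1)) (D : AbacusDiagram d n) :
    (mulTangle i D).arc (capL i) = capR i := capArc_left _ _ _

theorem mulTangle_arc_capR (i : Fin (n - 1)) (D : AbacusDiagram d n) :
    (mulTangle i D).arc (capR i) = capL i := capArc_right _ _ _

theorem mulTangle_beads_capL (i : Fin (n - 1)) (D : AbacusDiagram d n) :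
    (mulTangle i D).beads (capL i) = 0 := capBeads_left _ _ _ _

theorem mulTangle_beads_capR (i : Fin (n - 1)) (D : AbacusDiagram d n) :
    (mulTangle i D).beads (capR i) = 0 := capBeads_right _ _ _ _

theorem mulTangle_of_arc_eq {i : Fin (n - 1)} {D : AbacusDiagram d n}
    (h : D.arc (capL i) = capR i) (h0 : D.beads (capL i) = 0) : mulTangle i D = D := by
  ext p
  · exact capArc_of_apply_eq D.arc_arc h p
  · rw [mulTangle_beads, capBeads_of_apply_eq D.arc_arc _ h]
    split_ifs with h1
    · rcases h1 with rfl | rfl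
      · exact h0.symm
      · rw [← h, D.beads_arc, h0]
    · rfl

theorem mulTangle_mulTangle_self (i : Fin (n - 1)) (D : AbacusDiagram d n) :
    mulTangle i (mulTangle i D) = mulTangle i D :=
  mulTangle_of_arc_eq (mulTangle_arc_capL i D) (mulTangle_beads_capL i D)

theorem mulTangle_comm {i j : Fin (n - 1)} (h : i.1 + 1 < j.1 ∨ j.1 + 1 < i.1)
    (D : AbacusDiagram d n) : mulTangle j (mulTangle i D) = mulTangle i (mulTangle j D) := by
  have h1 : capL i ≠ capL j := fun h' ↦ by
    simpa [rightStrand] using (by omega : ¬ i.1 = j.1) (by simpa [rightStrand] using h')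
  have h2 : capL i ≠ capR j := fun h' ↦ by
    exact (by omega : ¬ i.1 + 1 = j.1) (by simpa [rightStrand, leftStrand] using h')
  have h3 : capR i ≠ capL j := fun h' ↦ by
    exact (by omega : ¬ i.1 = j.1 + 1) (by simpa [rightStrand, leftStrand] using h')
  have h4 : capR i ≠ capR j := fun h' ↦ by
    exact (by omega : ¬ i.1 = j.1) (by simpa [rightStrand, leftStrand] using h')
  ext p
  · exact capArc_capArc_comm D.arc_arc D.arc_ne (capL_ne_capR i) (capL_ne_capR j) h1 h2 h3 h4 p
  · exact capBeads_capBeads_comm D.arc_arc D.arc_ne D.beads_arc (capL_ne_capR i) (capL_ne_capR j)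
      h1 h2 h3 h4 p

theorem mulTangle_zigzag {i j : Fin (n - 1)} (h : i.1 + 1 = j.1 ∨ j.1 + 1 = i.1)
    (D : AbacusDiagram d n) :
    mulTangle i (mulTangle j (mulTangle i D)) = mulTangle i D := by
  generalize hE : mulTangle i D = E
  have hl : E.arc (capL i) = capR i := by rw [← hE, mulTangle_arc_capL]
  have hr : E.arc (capR i) = capL i := by rw [← hE, mulTangle_arc_capR]
  have bl : E.beads (capL i) = 0 := by rw [← hE, mulTangle_beads_capL]
  have br : E.beads (capR i) = 0 := by rw [← hE, mulTangle_beads_capR]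
  rcases h with h | h
  · have h1 : capR j = capL i := congrArg Sum.inr (Fin.ext h.symm)
    have h2 : capL j ≠ capL i := h1 ▸ capL_ne_capR j
    have h3 : capL j ≠ capR i := fun h' ↦ by
      exact (by omega : ¬ j.1 + 1 = i.1) (by simpa [rightStrand, leftStrand] using h')
    ext p
    · have := capArc_zigzag E.arc_arc E.arc_ne hl h2 h3 p
      rw [← h1] at this
      rw [mulTangle_arc, ← h1]
      exact this
    · have := capBeads_zigzag E.arc_arc E.arc_ne E.beads_arc hl h2 h3 bl p
      rw [← h1] at this
      rw [mulTangle_beads, ← h1]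
      exact this
  · have h1 : capL j = capR i := congrArg Sum.inr (Fin.ext h)
    have h2 : capR j ≠ capR i := h1 ▸ (capL_ne_capR j).symm
    have h3 : capR j ≠ capL i := fun h' ↦ by
      exact (by omega : ¬ j.1 = i.1 + 1) (by simpa [rightStrand, leftStrand] using h')
    have c1 : capArc E.arc (capL j) (capR j) = capArc E.arc (capR j) (capL j) :=
      funext (capArc_comm E.arc_arc _ _)
    have c2 : capBeads E.arc E.beads (capL j) (capR j) = capBeads E.arc E.beads (capR j) (capL j) :=
      funext (capBeads_comm E.arc_arc _ _ _)
    ext p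
    · rw [mulTangle_arc, capArc_comm (AbacusDiagram.arc_arc _), ← h1]
      have := capArc_zigzag E.arc_arc E.arc_ne hr h2 h3 p
      rw [← h1, ← c1] at this
      exact this
    · rw [mulTangle_beads, capBeads_comm (AbacusDiagram.arc_arc _), ← h1]
      have := capBeads_zigzag E.arc_arc E.arc_ne E.beads_arc hr h2 h3 br p
      rw [← h1, ← c1, ← c2] at this
      exact this

theorem mulTangle_addBeads {i : Fin (n - 1)} {α : EndPt n → ZMod d} (hl : α (capL i) = 0)
    (hr : α (capR i) = 0) (D : AbacusDiagram d n) :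
    mulTangle i (D.addBeads α) = (mulTangle i D).addBeads α := by
  ext p
  · rfl
  · have h1 := capBeads_spec D.arc (D.addBeads α).beads (capL i) (capR i) p
    have h2 := capBeads_spec D.arc D.beads (capL i) (capR i) p
    have h3 := capArc_spec D.arc (capL i) (capR i) p
    rw [mulTangle_beads, addBeads_arc, addBeads_beads, mulTangle_beads, mulTangle_arc]
    simp only [addBeads_beads] at h1
    generalize capBeads D.arc (D.addBeads α).beads (capL i) (capR i) p = y at *
    generalize capBeads D.arc D.beads (capL i) (capR i) p = z at *
    generalize capArc D.arc (capL i) (capR i) p = w at *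
    generalize capL i = u at *
    generalize capR i = v at *
    grind

theorem mulTangle_addBeads_of_ne {i : Fin (n - 1)} {p : EndPt n} (hl : p ≠ capL i)
    (hr : p ≠ capR i) (c : ZMod d) (D : AbacusDiagram d n) :
    mulTangle i (D.addBeads (Pi.single p c)) = (mulTangle i D).addBeads (Pi.single p c) :=
  mulTangle_addBeads (Pi.single_eq_of_ne' hl _) (Pi.single_eq_of_ne' hr _) D

theorem mulTangle_addBeads_of_arc_eq {i : Fin (n - 1)} {D : AbacusDiagram d n}
    (h : D.arc (capL i) = capR i) (c : ZMod d) :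
    mulTangle i (D.addBeads (Pi.single (capR i) c)) = mulTangle i D := by
  ext p
  · rfl
  · rw [mulTangle_beads, mulTangle_beads, capBeads_of_apply_eq D.arc_arc _ h]
    change capBeads D.arc _ _ _ p = _
    rw [capBeads_of_apply_eq D.arc_arc _ h]
    split_ifs with h1
    · rfl
    · rw [addBeads_beads, Pi.single_apply, Pi.single_apply, if_neg, if_neg]
      · simp
      · intro h'
        rw [← h] at h'
        have := congrArg D.arc h'
        rw [D.arc_arc, D.arc_arc] at this
        tauto
      · tauto

/-- If the two points lie on one arc, a bead is on the same arc in either case. Otherwise it slides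
to the far end of its arc, away from the bracket; the two far ends become partners once the tangle
is attached. -/
theorem mulTangle_addBeads_capL (i : Fin (n - 1)) (c : ZMod d) (D : AbacusDiagram d n) :
    mulTangle i (D.addBeads (Pi.single (capL i) c)) =
      mulTangle i (D.addBeads (Pi.single (capR i) c)) := by
  by_cases h : D.arc (capL i) = capR i
  · rw [← addBeads_single_arc, h]
  · have h1 : D.arc (capR i) ≠ capL i := fun h' ↦ h (by rw [← h', D.arc_arc])
    rw [← addBeads_single_arc D (capL i), ← addBeads_single_arc D (capR i),
      mulTangle_addBeads_of_ne (D.arc_ne _) h, mulTangle_addBeads_of_ne h1 (D.arc_ne _),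
      ← addBeads_single_arc (mulTangle i D) (D.arc (capL i))]
    congr 2
    rw [mulTangle_arc]
    unfold capArc
    rw [if_neg (D.arc_ne _), if_neg h, if_pos (D.arc_arc _)]

theorem mulTangle_addBeads_mulTangle (i : Fin (n - 1)) (c : ZMod d) (D : AbacusDiagram d n) :
    mulTangle i ((mulTangle i D).addBeads (Pi.single (capR i) c)) = mulTangle i D := by
  rw [mulTangle_addBeads_of_arc_eq (mulTangle_arc_capL i D), mulTangle_mulTangle_self]

/-! ### The right action of the framed Jones monoid -/

/-- The right action of a generator on diagrams. -/
def mulGen : JonesGen n → AbacusDiagram d n → AbacusDiagram d n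
  | .t i => mulTangle i
  | .z i => addBeads (Pi.single (.inr i) 1)

/-- The right action of a generator on diagrams, as an element of a monoid. -/
def opGen (d : ℕ) {n : ℕ} (g : JonesGen n) : (Function.End (AbacusDiagram d n))ᵐᵒᵖ :=
  MulOpposite.op (mulGen g)

/-- The right action of words on diagrams. -/
def mulWord (w : FreeMonoid (JonesGen n)) (D : AbacusDiagram d n) : AbacusDiagram d n :=
  (FreeMonoid.lift (opGen d) w).unop D

@[simp]
theorem mulWord_one (D : AbacusDiagram d n) : mulWord 1 D = D := rfl

@[simp]
theorem mulWord_mul (w w' : FreeMonoid (JonesGen n)) (D : AbacusDiagram d n) :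
    mulWord (w * w') D = mulWord w' (mulWord w D) := by
  unfold mulWord
  rw [map_mul]
  rfl

@[simp]
theorem mulWord_wordT (i : Fin (n - 1)) (D : AbacusDiagram d n) :
    mulWord (wordT i) D = mulTangle i D := rfl

@[simp]
theorem mulWord_wordZ (i : Fin n) (D : AbacusDiagram d n) :
    mulWord (wordZ i) D = D.addBeads (Pi.single (.inr i) 1) := rfl

@[simp]
theorem mulWord_wordZ_pow (i : Fin n) (k : ℕ) (D : AbacusDiagram d n) :
    mulWord (wordZ i ^ k) D = D.addBeads (Pi.single (.inr i) (k : ZMod d)) := by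
  induction k with
  | zero => simp
  | succ k ih => rw [pow_succ, mulWord_mul, ih, mulWord_wordZ, addBeads_addBeads, ← Pi.single_add,
      Nat.cast_succ]

theorem mulWord_eq_of_rel {w w' : FreeMonoid (JonesGen n)} (h : FramedJonesRel d n w w')
    (D : AbacusDiagram d n) : mulWord w D = mulWord w' D := by
  cases h with
  | t_sq i => simp [sq, mulTangle_mulTangle_self]
  | t_comm i j h => simpa using mulTangle_comm h D
  | t_t_t i j h => simpa using mulTangle_zigzag h D
  | z_pow i => simp
  | z_comm i j => simp [addBeads_addBeads, add_comm]
  | t_z i =>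
    simp only [mulWord_mul, mulWord_wordT, mulWord_wordZ]
    rw [← addBeads_single_arc, mulTangle_arc_capR]
  | z_t i => simpa using (mulTangle_addBeads_capL i 1 D).symm
  | z_t_comm i j hl hr =>
    simp only [mulWord_mul, mulWord_wordT, mulWord_wordZ]
    exact mulTangle_addBeads_of_ne (fun h ↦ hr (Sum.inr_injective h))
      (fun h ↦ hl (Sum.inr_injective h)) _ _
  | t_z_t i k => simpa using mulTangle_addBeads_mulTangle i (k : ZMod d) D

/-- The right action of the framed Jones monoid on diagrams. -/
def rightAction (d n : ℕ) : FramedJones d n →* (Function.End (AbacusDiagram d n))ᵐᵒᵖ :=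
  PresentedMonoid.lift (opGen d) fun _ _ h ↦
    MulOpposite.unop_injective (funext fun D ↦ mulWord_eq_of_rel h D)

/-- The diagram of an element of the framed Jones monoid. -/
def ofJones (x : FramedJones d n) : AbacusDiagram d n :=
  (rightAction d n x).unop (idDiagram d n)

@[simp]
theorem ofJones_one : ofJones (1 : FramedJones d n) = idDiagram d n := rfl

@[simp]
theorem ofJones_mul_t (x : FramedJones d n) (i : Fin (n - 1)) :
    ofJones (x * FramedJones.t d i) = mulTangle i (ofJones x) := by
  unfold ofJones
  rw [map_mul]
  rfl

@[simp]
theorem ofJones_mul_z (x : FramedJones d n) (i : Fin n) :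
    ofJones (x * FramedJones.z d i) = (ofJones x).addBeads (Pi.single (.inr i) 1) := by
  unfold ofJones
  rw [map_mul]
  rfl

end AbacusDiagram

/-! ### Relations and normal forms in the framed Jones monoid -/

/-- An induction principle for the framed Jones monoid. -/
theorem FramedJones.induction_right {d n : ℕ} {motive : FramedJones d n → Prop} (one : motive 1)
    (mul_t : ∀ x i, motive x → motive (x * FramedJones.t d i))
    (mul_z : ∀ x i, motive x → motive (x * FramedJones.z d i)) (x : FramedJones d n) :
    motive x := by
  refine Submonoid.induction_of_closure_eq_top_right
    (PresentedMonoid.closure_range_of (FramedJonesRel d n)) x one ?_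
  rintro x _ ⟨g | g, rfl⟩ hx
  · exact mul_t x g hx
  · exact mul_z x g hx

namespace FramedJones

variable {d n : ℕ}

theorem t_mul_t (i : Fin (n - 1)) : t d i * t d i = t d i := by
  have h := PresentedMonoid.mk_eq_mk_of_rel (FramedJonesRel.t_sq (d := d) i)
  rwa [sq, map_mul] at h

theorem t_comm {i j : Fin (n - 1)} (h : i.1 + 1 < j.1 ∨ j.1 + 1 < i.1) :
    Commute (t d i) (t d j) := by
  have h := PresentedMonoid.mk_eq_mk_of_rel (FramedJonesRel.t_comm (d := d) i j h)
  rwa [map_mul, map_mul] at h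

theorem t_mul_t_mul_t {i j : Fin (n - 1)} (h : i.1 + 1 = j.1 ∨ j.1 + 1 = i.1) :
    t d i * t d j * t d i = t d i := by
  have h := PresentedMonoid.mk_eq_mk_of_rel (FramedJonesRel.t_t_t (d := d) i j h)
  rwa [map_mul, map_mul] at h

theorem z_pow (i : Fin n) : z d i ^ d = 1 := by
  have h := PresentedMonoid.mk_eq_mk_of_rel (FramedJonesRel.z_pow (d := d) i)
  rwa [map_pow, map_one] at h

theorem z_comm (i j : Fin n) : Commute (z d i) (z d j) := by
  have h := PresentedMonoid.mk_eq_mk_of_rel (FramedJonesRel.z_comm (d := d) i j)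
  rwa [map_mul, map_mul] at h

theorem t_mul_z (i : Fin (n - 1)) : t d i * z d (leftStrand i) = t d i * z d (rightStrand i) := by
  have h := PresentedMonoid.mk_eq_mk_of_rel (FramedJonesRel.t_z (d := d) i)
  rwa [map_mul, map_mul] at h

theorem z_mul_t (i : Fin (n - 1)) : z d (leftStrand i) * t d i = z d (rightStrand i) * t d i := by
  have h := PresentedMonoid.mk_eq_mk_of_rel (FramedJonesRel.z_t (d := d) i)
  rwa [map_mul, map_mul] at h

theorem z_comm_t {i : Fin n} {j : Fin (n - 1)} (hl : i ≠ leftStrand j) (hr : i ≠ rightStrand j) :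
    Commute (z d i) (t d j) := by
  have h := PresentedMonoid.mk_eq_mk_of_rel (FramedJonesRel.z_t_comm (d := d) i j hl hr)
  rwa [map_mul, map_mul] at h

theorem t_mul_z_pow_mul_t (i : Fin (n - 1)) (k : ℕ) :
    t d i * z d (leftStrand i) ^ k * t d i = t d i := by
  have h := PresentedMonoid.mk_eq_mk_of_rel (FramedJonesRel.t_z_t (d := d) i k)
  rwa [map_mul, map_mul, map_pow] at h

theorem t_mul_z_pow (i : Fin (n - 1)) (k : ℕ) :
    t d i * z d (leftStrand i) ^ k = t d i * z d (rightStrand i) ^ k := by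
  induction k with
  | zero => simp
  | succ k ih =>
    rw [pow_succ, ← mul_assoc, ih, mul_assoc, ← ((z_comm _ _).pow_right k).eq, ← mul_assoc,
      t_mul_z, mul_assoc, ← pow_succ']

theorem z_pow_mul_t (i : Fin (n - 1)) (k : ℕ) :
    z d (leftStrand i) ^ k * t d i = z d (rightStrand i) ^ k * t d i := by
  induction k with
  | zero => simp
  | succ k ih =>
    rw [pow_succ', mul_assoc, ih, ← mul_assoc, ((z_comm _ _).pow_right k).eq, mul_assoc,
      z_mul_t, ← mul_assoc, ← pow_succ]

theorem z_pow_val_natCast (i : Fin n) (k : ℕ) : z d i ^ (k : ZMod d).val = z d i ^ k := by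
  rw [ZMod.val_natCast, ← pow_eq_pow_mod k (z_pow i)]


open AbacusDiagram

/-- Left multiplication is not built into the right action. It is reached by induction on the right
factor, as a bead at a top endpoint commutes with everything attached at the bottom. -/
theorem ofJones_z_mul (i : Fin n) (x : FramedJones d n) :
    ofJones (z d i * x) = (ofJones x).addBeads (Pi.single (.inl i) 1) := by
  induction x using induction_right with
  | one =>
    rw [mul_one, ← one_mul (z d i), ofJones_mul_z, ofJones_one]
    exact addBeads_single_arc (idDiagram d n) (.inl i) 1
  | mul_t x j ih =>
    rw [← mul_assoc, ofJones_mul_t, ih, mulTangle_addBeads_of_ne (by simp) (by simp),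
      ofJones_mul_t]
  | mul_z x j ih =>
    rw [← mul_assoc, ofJones_mul_z, ih, ofJones_mul_z, addBeads_addBeads, addBeads_addBeads,
      add_comm]

theorem ofJones_z_pow_mul (i : Fin n) (k : ℕ) (x : FramedJones d n) :
    ofJones (z d i ^ k * x) = (ofJones x).addBeads (Pi.single (.inl i) (k : ZMod d)) := by
  induction k with
  | zero => simp
  | succ k ih =>
    rw [pow_succ', mul_assoc, ofJones_z_mul, ih, addBeads_addBeads, ← Pi.single_add, Nat.cast_succ]

theorem ofJones_mul_z_pow (i : Fin n) (k : ℕ) (x : FramedJones d n) :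
    ofJones (x * z d i ^ k) = (ofJones x).addBeads (Pi.single (.inr i) (k : ZMod d)) := by
  induction k with
  | zero => simp
  | succ k ih =>
    rw [pow_succ, ← mul_assoc, ofJones_mul_z, ih, addBeads_addBeads, ← Pi.single_add, Nat.cast_succ]

/-- The generators `t_i` as a sequence. -/
def tSeq (d n : ℕ) (k : ℕ) : FramedJones d n :=
  if h : k < n - 1 then t d ⟨k, h⟩ else 1

theorem tSeq_of_lt {k : ℕ} (h : k < n - 1) : tSeq d n k = t d ⟨k, h⟩ := dif_pos h

theorem isJonesFamily_tSeq : IsJonesFamily (tSeq d n) (n - 1) where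
  mul_self i hi := by rw [tSeq_of_lt hi, t_mul_t]
  comm i j hij hj := by
    rw [tSeq_of_lt (by omega), tSeq_of_lt hj]
    exact t_comm (.inl hij)
  mul_succ_mul i hi := by
    rw [tSeq_of_lt (by omega), tSeq_of_lt hi]
    exact t_mul_t_mul_t (.inl rfl)
  succ_mul_mul i hi := by
    rw [tSeq_of_lt hi, tSeq_of_lt (by omega)]
    exact t_mul_t_mul_t (.inr rfl)

/-- The normal form of a matching in the framed Jones monoid. -/
noncomputable def ofMatching (d : ℕ) (M : NCMatching n) : FramedJones d n :=
  M.toProd (tSeq d n)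

theorem ofMatching_vertical : ofMatching d (NCMatching.vertical n) = 1 :=
  NCMatching.toProd_vertical isJonesFamily_tSeq (by omega)

theorem ofMatching_insertArc_contract {m : ℕ} (hm : m ≤ 2 * n) (hnm : n < m)
    (M : NCMatching (n + 1)) :
    ofMatching d (M.contract m hm |>.insertArc m hm) =
      ofMatching d M * t d ⟨2 * n - m, by omega⟩ := by
  rw [ofMatching, NCMatching.toProd_insertArc_contract isJonesFamily_tSeq (by omega) hm hnm,
    tSeq_of_lt (by omega), ofMatching]

theorem ofMatching_toMatching_mulTangle (i : Fin (n - 1)) (D : AbacusDiagram d n) :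
    ofMatching d (mulTangle i D).toMatching = ofMatching d D.toMatching * t d i := by
  cases n with
  | zero => exact i.elim0
  | succ n =>
    have hi := i.2
    rw [toMatching_mulTangle, ofMatching_insertArc_contract _ (by omega)]
    congr 2
    ext
    simp only
    omega

theorem toMatching_ofJones_ofMatching (M : NCMatching n) :
    (ofJones (ofMatching d M)).toMatching = M := by
  induction NCMatching.reachable M with
  | vertical n => rw [ofMatching_vertical, ofJones_one, toMatching_idDiagram]
  | step n m hm hnm M _ ih =>
    rw [ofMatching_insertArc_contract hm hnm, ofJones_mul_t, toMatching_mulTangle, ih]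
    congr 2 <;> simp only <;> omega

theorem ofJones_ofMatching_arc (D : AbacusDiagram d n) :
    (ofJones (ofMatching d D.toMatching)).arc = D.arc :=
  toMatching_eq_iff.1 (toMatching_ofJones_ofMatching _)

/-- All beads of an arc are put at its end with the larger key; the choice of `key` decides which
endpoints stay empty. -/
theorem exists_spread {ι R : Type*} [AddCommMonoid R] {f : ι → ι} (hf : ∀ p, f (f p) = p)
    (hne : ∀ p, f p ≠ p) {b : ι → R} (hb : ∀ p, b (f p) = b p) {key : ι → ℕ}
    (hkey : Function.Injective key) :
    ∃ α : ι → R, (∀ p, α p + α (f p) = b p) ∧ ∀ p, key p < key (f p) → α p = 0 := by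
  refine ⟨fun p ↦ if key (f p) < key p then b p else 0, fun p ↦ ?_, fun p hp ↦ ?_⟩
  · have := hkey.ne (hne p)
    simp only [hf, hb]
    rcases lt_or_ge (key (f p)) (key p) with h | h
    · rw [if_pos h, if_neg (by omega), add_zero]
    · rw [if_neg (by omega), if_pos (by omega), zero_add]
  · simp only
    rw [if_neg (by omega)]

theorem exists_beads_eq (D : AbacusDiagram d n) :
    ∃ α : EndPt n → ZMod d, ∀ p, α p + α (D.arc p) = D.beads p := by
  obtain ⟨α, h, -⟩ := exists_spread D.arc_arc D.arc_ne D.beads_arc (boundaryPos_injective n)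
  exact ⟨α, h⟩

/-- Beads away from the bracket commute with `t_i`, so they are moved off `capL i` and `capR i`
where possible. The exception is an arc joining these two points; its beads are put at `capR i`. -/
theorem exists_beads_eq_of_tangle (D : AbacusDiagram d n) (i : Fin (n - 1)) :
    ∃ α : EndPt n → ZMod d, (∀ p, α p + α (D.arc p) = D.beads p) ∧ α (capL i) = 0 ∧
      (D.arc (capL i) ≠ capR i → α (capR i) = 0) := by
  have hlr := capL_ne_capR i
  -- The two bracket points get the smallest keys, so that beads go to the other end of their arcs.
  have hkey : Function.Injective fun p : EndPt n ↦
      if p = capL i then 0 else if p = capR i then 1 else boundaryPos p + 2 := by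
    intro p q h
    simp only at h
    split_ifs at h with h1 h2 h3 h4 h5 h6 h7
    · rw [h1, h2]
    · rw [h4, h6]
    · omega
    · omega
    · exact boundaryPos_injective n (by omega)
  obtain ⟨α, h, h0⟩ := exists_spread D.arc_arc D.arc_ne D.beads_arc hkey
  refine ⟨α, h, h0 _ ?_, fun h1 ↦ h0 _ ?_⟩
  · have := D.arc_ne (capL i)
    simp only [if_true, if_neg this]
    split_ifs <;> omega
  · have h2 : D.arc (capR i) ≠ capL i := fun h3 ↦ h1 (by rw [← h3, D.arc_arc])
    simp [h2, hlr.symm, D.arc_ne (capR i)]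

variable [NeZero d]

/-! ### Placing beads on elements of the monoid; bijectivity of `ofJones` -/

/-- The powers of `z_i`, with exponents modulo `d`. -/
def zPow (i : Fin n) : Multiplicative (ZMod d) →* FramedJones d n where
  toFun c := z d i ^ (Multiplicative.toAdd c).val
  map_one' := by simp
  map_mul' a b := by
    rw [toAdd_mul, ZMod.val_add, ← pow_eq_pow_mod _ (z_pow i), pow_add]

theorem zPow_comm (i j : Fin n) (a b : Multiplicative (ZMod d)) :
    Commute (zPow i a) (zPow j b) :=
  (z_comm i j).pow_pow _ _

theorem pairwise_zPow_comm : Pairwise fun i j : Fin n ↦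
    ∀ a b : Multiplicative (ZMod d), Commute (zPow i a) (zPow j b) :=
  fun i j _ ↦ zPow_comm i j

/-- The product of powers of all `z_i`, with exponents modulo `d`. -/
def zProd (a : Fin n → ZMod d) : FramedJones d n :=
  MonoidHom.noncommPiCoprod zPow pairwise_zPow_comm fun i ↦ Multiplicative.ofAdd (a i)

@[simp]
theorem zProd_zero : zProd (0 : Fin n → ZMod d) = 1 :=
  map_one (MonoidHom.noncommPiCoprod (zPow (d := d) (n := n)) pairwise_zPow_comm)

theorem zProd_add (a b : Fin n → ZMod d) : zProd (a + b) = zProd a * zProd b :=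
  map_mul (MonoidHom.noncommPiCoprod (zPow (d := d) (n := n)) pairwise_zPow_comm)
    (fun i ↦ Multiplicative.ofAdd (a i)) (fun i ↦ Multiplicative.ofAdd (b i))

theorem zProd_single (i : Fin n) (c : ZMod d) : zProd (Pi.single i c) = z d i ^ c.val := by
  have h := MonoidHom.noncommPiCoprod_mulSingle (ϕ := zPow (d := d) (n := n))
    (hcomm := pairwise_zPow_comm) i (Multiplicative.ofAdd c)
  exact h

theorem zProd_comm_t {i : Fin (n - 1)} {a : Fin n → ZMod d} (hl : a (leftStrand i) = 0)
    (hr : a (rightStrand i) = 0) : Commute (t d i) (zProd a) := by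
  unfold zProd
  rw [MonoidHom.noncommPiCoprod_apply]
  refine Finset.noncommProd_commute _ _ _ _ fun j _ ↦ ?_
  change Commute (t d i) (z d j ^ (a j).val)
  by_cases h1 : j = leftStrand i
  · simp [h1, hl]
  by_cases h2 : j = rightStrand i
  · simp [h2, hr]
  exact (z_comm_t h1 h2).symm.pow_right _

/-- Put `α p` beads at the endpoint `p` of an element, for each `p`. -/
def act (α : EndPt n → ZMod d) (x : FramedJones d n) : FramedJones d n :=
  zProd (fun i ↦ α (.inl i)) * x * zProd fun i ↦ α (.inr i)

theorem act_add (α β : EndPt n → ZMod d) (x : FramedJones d n) :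
    act (α + β) x = act α (act β x) := by
  have h : act (α + β) x = zProd ((fun i ↦ α (.inl i)) + fun i ↦ β (.inl i)) * x *
    zProd ((fun i ↦ β (.inr i)) + fun i ↦ α (.inr i)) := by rw [add_comm (fun i ↦ β _)]; rfl
  rw [h, zProd_add, zProd_add]
  simp only [act, mul_assoc]

@[simp]
theorem act_zero (x : FramedJones d n) : act 0 x = x := by
  have : ∀ x : FramedJones d n, act 0 x = zProd 0 * x * zProd 0 := fun _ ↦ rfl
  simp [this]

theorem act_single_inl (i : Fin n) (c : ZMod d) (x : FramedJones d n) :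
    act (Pi.single (.inl i) c) x = z d i ^ c.val * x := by
  have h1 : (fun j ↦ (Pi.single (.inl i) c : EndPt n → ZMod d) (.inl j)) = Pi.single i c := by
    ext j
    simp [Pi.single_apply]
  have h2 : (fun j ↦ (Pi.single (.inl i) c : EndPt n → ZMod d) (.inr j)) = 0 := by
    ext j
    simp
  rw [act, h1, h2, zProd_zero, mul_one, zProd_single]

theorem act_single_inr (i : Fin n) (c : ZMod d) (x : FramedJones d n) :
    act (Pi.single (.inr i) c) x = x * z d i ^ c.val := by
  have h1 : (fun j ↦ (Pi.single (.inr i) c : EndPt n → ZMod d) (.inr j)) = Pi.single i c := by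
    ext j
    simp [Pi.single_apply]
  have h2 : (fun j ↦ (Pi.single (.inr i) c : EndPt n → ZMod d) (.inl j)) = 0 := by
    ext j
    simp
  rw [act, h1, h2, zProd_zero, one_mul, zProd_single]

theorem mul_z_eq_act (x : FramedJones d n) (i : Fin n) :
    x * z d i = act (Pi.single (.inr i) 1) x := by
  rw [act_single_inr, ← Nat.cast_one, z_pow_val_natCast, pow_one]

theorem act_mul_t {i : Fin (n - 1)} {α : EndPt n → ZMod d} (hl : α (AbacusDiagram.capL i) = 0)
    (hr : α (AbacusDiagram.capR i) = 0) (x : FramedJones d n) :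
    act α (x * t d i) = act α x * t d i := by
  have h := zProd_comm_t (i := i) (a := fun j ↦ α (.inr j)) hr hl
  simp only [act, mul_assoc, h.eq]

theorem act_comm (α β : EndPt n → ZMod d) (x : FramedJones d n) :
    act α (act β x) = act β (act α x) := by
  rw [← act_add, add_comm, act_add]

/-- The relations let a bead travel along a strand: through vertical lines of the identity, across
the lower bracket by `t_mul_z_pow`, and across the upper bracket by `z_pow_mul_t`. After
multiplication by `t_i` a new arc may consist of two old ones, and the bead then slides along both.
-/
theorem act_single_arc (x : FramedJones d n) (p : EndPt n) (c : ZMod d) :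
    act (Pi.single ((ofJones x).arc p) c) x = act (Pi.single p c) x := by
  induction x using induction_right generalizing p with
  | one =>
    rcases p with i | i <;> simp [idDiagram, act_single_inl, act_single_inr]
  | mul_z x i ih =>
    rw [ofJones_mul_z, addBeads_arc, mul_z_eq_act, act_comm, ih, act_comm]
  | mul_t x i ih =>
    have hz : act (Pi.single (capL i) c) (x * t d i) = act (Pi.single (capR i) c) (x * t d i) := by
      rw [act_single_inr, act_single_inr, mul_assoc, mul_assoc, t_mul_z_pow]
    have hz' : act (Pi.single (capL i) c) x * t d i = act (Pi.single (capR i) c) x * t d i := by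
      rw [act_single_inr, act_single_inr, mul_assoc, mul_assoc, z_pow_mul_t]
    have hc : ∀ q, q ≠ capL i → q ≠ capR i →
        act (Pi.single q c) (x * t d i) = act (Pi.single q c) x * t d i := fun q h1 h2 ↦
      act_mul_t (Pi.single_eq_of_ne' h1 _) (Pi.single_eq_of_ne' h2 _) x
    have ha := (ofJones x).arc_arc
    have hn := (ofJones x).arc_ne
    rw [ofJones_mul_t, mulTangle_arc]
    rcases capArc_spec (ofJones x).arc (capL i) (capR i) p with
      ⟨h1, h⟩ | ⟨-, h1, h⟩ | ⟨h1, h2, h3, h⟩ | ⟨h1, h2, h3, h4, h⟩ | ⟨h1, h2, h3, h4, h⟩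
    · rw [h, h1, hz]
    · rw [h, h1, hz]
    · have h4 : p = (ofJones x).arc (capL i) := by rw [← h3, ha]
      have h5 : (ofJones x).arc (capR i) ≠ capL i := fun h5 ↦ h2 (by rw [h4, ← h5, ha])
      rw [h, hc _ h5 (hn _), hc p h1 h2, ih, ← hz', ← ih (capL i), h4]
    · have h5 : p = (ofJones x).arc (capR i) := by rw [← h4, ha]
      have h6 : (ofJones x).arc (capL i) ≠ capR i := fun h6 ↦ h1 (by rw [h5, ← h6, ha])
      rw [h, hc _ (hn _) h6, hc p h1 h2, ih, hz', ← ih (capR i), h5]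
    · rw [h, hc _ h3 h4, hc _ h1 h2, ih]

/-- Such a `γ` is a sum over arcs of a bead number at one end and its negative at the other, and by
`act_single_arc` each summand acts trivially on `x`. -/
theorem act_eq_self (x : FramedJones d n) {γ : EndPt n → ZMod d}
    (h : ∀ p, γ ((ofJones x).arc p) = - γ p) : act γ x = x := by
  set f := (ofJones x).arc with hf
  have ff : ∀ p, f (f p) = p := (ofJones x).arc_arc
  let S : AddSubmonoid (EndPt n → ZMod d) :=
    { carrier := {γ | act γ x = x}
      zero_mem' := act_zero x
      add_mem' := fun {a b} ha hb ↦ by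
        change act (a + b) x = x
        rw [act_add, show act b x = x from hb, show act a x = x from ha] }
  have key : ∀ p c, Pi.single p c + Pi.single (f p) (-c) ∈ S := by
    intro p c
    change act _ x = x
    rw [act_add, act_single_arc, ← act_add, ← Pi.single_add, add_neg_cancel, Pi.single_zero,
      act_zero]
  have hγ : γ = ∑ p with boundaryPos p < boundaryPos (f p),
      (Pi.single p (γ p) + Pi.single (f p) (-γ p)) := by
    rw [Finset.sum_add_distrib]
    conv_lhs => rw [← Finset.univ_sum_single γ,
      ← Finset.sum_filter_add_sum_filter_not _ fun p ↦ boundaryPos p < boundaryPos (f p)]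
    congr 1
    -- The right ends are reindexed by their left ends, where `γ` changes sign.
    refine Finset.sum_nbij' f f ?_ ?_ (fun p _ ↦ ff p) (fun p _ ↦ ff p) ?_
    · intro p hp
      have h1 := (boundaryPos_injective n).ne ((ofJones x).arc_ne p)
      simp only [Finset.mem_filter, Finset.mem_univ, true_and, ff] at hp ⊢
      rw [← hf] at h1
      omega
    · intro p hp
      simp only [Finset.mem_filter, Finset.mem_univ, true_and, ff] at hp ⊢
      omega
    · intro p hp
      rw [ff, h, neg_neg]
  change γ ∈ S
  rw [hγ]
  exact S.sum_mem fun p _ ↦ key p _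

theorem act_eq_act (x : FramedJones d n) {α β : EndPt n → ZMod d}
    (h : ∀ p, α p + α ((ofJones x).arc p) = β p + β ((ofJones x).arc p)) :
    act α x = act β x := by
  have h1 : act (α - β) x = x := act_eq_self x fun p ↦ by
    have := h p
    simp only [Pi.sub_apply]
    linear_combination this
  conv_rhs => rw [← h1, ← act_add, add_sub_cancel]

theorem ofJones_act (α : EndPt n → ZMod d) (x : FramedJones d n) :
    ofJones (act α x) = (ofJones x).addBeads α := by
  let S : AddSubmonoid (EndPt n → ZMod d) :=
    { carrier := {α | ∀ x : FramedJones d n, ofJones (act α x) = (ofJones x).addBeads α}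
      zero_mem' := fun x ↦ by simp
      add_mem' := fun {a b} ha hb x ↦ by
        rw [act_add, ha, hb, addBeads_addBeads, add_comm] }
  have key : ∀ p c, Pi.single p c ∈ S := by
    rintro (i | i) c x
    · rw [act_single_inl, ofJones_z_pow_mul, ZMod.natCast_zmod_val]
    · rw [act_single_inr, ofJones_mul_z_pow, ZMod.natCast_zmod_val]
  have : α ∈ S := by
    rw [← Finset.univ_sum_single α]
    exact S.sum_mem fun p _ ↦ key p _
  exact this x

/-- The statement holds for every `α` with the right sums over arcs, which lets the induction step
for `t_i` choose a distribution that clears the bracket. Beads then commute past `t_i`, and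
`ofMatching` absorbs it. If `t_i` closes a loop, the beads on the loop are killed by `t_i * z ^ k *
t_i = t_i`. -/
theorem eq_act_ofMatching (x : FramedJones d n) {α : EndPt n → ZMod d}
    (h : ∀ p, α p + α ((ofJones x).arc p) = (ofJones x).beads p) :
    x = act α (ofMatching d (ofJones x).toMatching) := by
  induction x using induction_right generalizing α with
  | one =>
    rw [ofJones_one, toMatching_idDiagram, ofMatching_vertical, act_eq_self]
    intro p
    exact eq_neg_of_add_eq_zero_right (h p)
  | mul_z x i ih =>
    obtain ⟨β, hβ⟩ := exists_beads_eq (ofJones x)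
    rw [ofJones_mul_z, toMatching_addBeads, mul_z_eq_act]
    conv_lhs => rw [ih hβ]
    rw [← act_add]
    refine act_eq_act _ fun p ↦ ?_
    rw [ofJones_mul_z] at h
    have h1 := h p
    have h2 := hβ p
    rw [addBeads_arc, addBeads_beads] at h1
    rw [ofJones_ofMatching_arc, Pi.add_apply, Pi.add_apply]
    linear_combination h2 - h1
  | mul_t x i ih =>
    obtain ⟨β, hβ, hl, hr⟩ := exists_beads_eq_of_tangle (ofJones x) i
    rw [ofJones_mul_t] at h ⊢
    have hact : ∀ γ : EndPt n → ZMod d, (∀ p, γ p + γ ((mulTangle i (ofJones x)).arc p) =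
          (mulTangle i (ofJones x)).beads p) →
        act γ (ofMatching d (ofJones x).toMatching * t d i) =
          act α (ofMatching d (mulTangle i (ofJones x)).toMatching) := by
      intro γ hγ
      rw [← ofMatching_toMatching_mulTangle]
      refine act_eq_act _ fun p ↦ ?_
      rw [ofJones_ofMatching_arc, hγ, h]
    conv_lhs => rw [ih hβ]
    by_cases hc : (ofJones x).arc (capL i) = capR i
    · have hM : ofMatching d (ofJones x).toMatching * t d i =
          ofMatching d (ofJones x).toMatching := by
        rw [← ofMatching_toMatching_mulTangle]
        congr 1
        rw [toMatching_eq_iff]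
        exact funext (capArc_of_apply_eq (ofJones x).arc_arc hc)
      -- The beads on the loop, all at `capR i`, are separated from the rest, which commute with
      -- `t_i`.
      have hsplit : β = Function.update β (capR i) 0 + Pi.single (capR i) (β (capR i)) := by
        ext p
        by_cases hp : p = capR i
        · simp [hp]
        · simp [hp]
      have hcancel : act (Pi.single (capR i) (β (capR i))) (ofMatching d (ofJones x).toMatching) *
          t d i = ofMatching d (ofJones x).toMatching * t d i := by
        rw [act_single_inr, ← hM, mul_assoc, mul_assoc, mul_assoc, ← mul_assoc (t d i),
          t_mul_z_pow_mul_t, t_mul_t]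
      have h0 : Function.update β (capR i) 0 (capL i) = 0 := by
        rw [Function.update_of_ne (capL_ne_capR i), hl]
      rw [hsplit, act_add, ← act_mul_t h0 (by simp), hcancel]
      refine hact _ fun p ↦ ?_
      rw [mulTangle_arc, mulTangle_beads, capArc_of_apply_eq (arc_arc _) hc,
        capBeads_of_apply_eq (arc_arc _) _ hc]
      have hc' : (ofJones x).arc (capR i) = capL i := by rw [← hc, arc_arc]
      split_ifs with hp
      · rcases hp with rfl | rfl
        · rw [hc, h0, Function.update_self, add_zero]
        · rw [hc', h0, Function.update_self, add_zero]
      · rw [Function.update_of_ne (by tauto), Function.update_of_ne, hβ]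
        intro hp'
        rw [← hc', ← hp', arc_arc] at hp
        simp at hp
    · rw [← act_mul_t hl (hr hc)]
      refine hact β fun p ↦ ?_
      have hr := hr hc
      rw [mulTangle_arc, mulTangle_beads]
      have e1 := hβ p
      have e2 := hβ (capL i)
      have e3 := hβ (capR i)
      have h1 := capBeads_spec (ofJones x).arc (ofJones x).beads (capL i) (capR i) p
      have h3 := capArc_spec (ofJones x).arc (capL i) (capR i) p
      generalize capBeads (ofJones x).arc (ofJones x).beads (capL i) (capR i) p = z at *
      generalize capArc (ofJones x).arc (capL i) (capR i) p = w at *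
      generalize capL i = u at *
      generalize capR i = v at *
      grind

theorem ofJones_injective : Function.Injective (ofJones (d := d) (n := n)) := by
  intro x y h
  obtain ⟨α, hα⟩ := exists_beads_eq (ofJones x)
  rw [eq_act_ofMatching x hα]
  rw [h] at hα ⊢
  exact (eq_act_ofMatching y hα).symm

theorem ofJones_surjective : Function.Surjective (ofJones (d := d) (n := n)) := by
  intro D
  have harc := ofJones_ofMatching_arc D
  obtain ⟨α, hα⟩ := exists_beads_eq D
  obtain ⟨β, hβ⟩ := exists_beads_eq (ofJones (ofMatching d D.toMatching))
  refine ⟨act (α - β) (ofMatching d D.toMatching), ?_⟩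
  rw [ofJones_act]
  ext p
  · rw [addBeads_arc, harc]
  · rw [addBeads_beads, harc]
    have h1 := hα p
    have h2 := hβ p
    rw [harc] at h2
    simp only [Pi.sub_apply]
    linear_combination h1 - h2

/-- Elements of the framed Jones monoid correspond to diagrams. -/
noncomputable def equivDiagram (d n : ℕ) [NeZero d] : FramedJones d n ≃ AbacusDiagram d n :=
  Equiv.ofBijective ofJones ⟨ofJones_injective, ofJones_surjective⟩

end FramedJones

namespace AbacusDiagram

variable {d n : ℕ}

/-! ### Concatenation -/

/-- From each place in the stack, the arc there determines the only rule that applies, so tracing a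
strand is deterministic. -/
theorem Strand.unique {D E : AbacusDiagram d n} {s : EndPt n ⊕ EndPt n} {q q' : EndPt n}
    {b b' : ZMod d} (h : Strand D E s q b) (h' : Strand D E s q' b') : q = q' ∧ b = b' := by
  induction h generalizing q' b' with
  | exit_top p j h =>
    cases h' with
    | exit_top _ k h1 => exact ⟨by rw [← h, h1], rfl⟩
    | go_down _ k h1 => rw [h] at h1; cases h1
  | go_down p j h q b hs ih =>
    cases h' with
    | exit_top _ k h1 => rw [h] at h1; cases h1
    | go_down _ k h1 _ _ hs' =>
      obtain rfl : j = k := Sum.inr_injective (h ▸ h1)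
      obtain ⟨rfl, rfl⟩ := ih hs'
      exact ⟨rfl, rfl⟩
  | exit_bottom p j h =>
    cases h' with
    | exit_bottom _ k h1 => exact ⟨by rw [← h, h1], rfl⟩
    | go_up _ k h1 => rw [h] at h1; cases h1
  | go_up p j h q b hs ih =>
    cases h' with
    | exit_bottom _ k h1 => rw [h] at h1; cases h1
    | go_up _ k h1 _ _ hs' =>
      obtain rfl : j = k := Sum.inl_injective (h ▸ h1)
      obtain ⟨rfl, rfl⟩ := ih hs'
      exact ⟨rfl, rfl⟩

theorem IsConcat.unique {D E F F' : AbacusDiagram d n} (h : IsConcat D E F)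
    (h' : IsConcat D E F') : F = F' := by
  ext p
  · rcases p with i | i
    · exact ((h.1 i).unique (h'.1 i)).1
    · exact ((h.2 i).unique (h'.2 i)).1
  · rcases p with i | i
    · exact ((h.1 i).unique (h'.1 i)).2
    · exact ((h.2 i).unique (h'.2 i)).2

theorem isConcat_idDiagram (D : AbacusDiagram d n) : IsConcat D (idDiagram d n) D := by
  have key : ∀ p : EndPt n, Strand D (idDiagram d n) (.inl p) (D.arc p) (D.beads p) := by
    intro p
    cases h : D.arc p with
    | inl j => exact .exit_top p j h
    | inr j =>
      rw [← add_zero (D.beads p)]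
      exact .go_down p j h _ _ (.exit_bottom (.inl j) j rfl)
  refine ⟨fun i ↦ key _, fun i ↦ ?_⟩
  rw [← zero_add (D.beads (.inr i))]
  exact .go_up (.inr i) i rfl _ _ (key _)

/-- The place in a stack of two diagrams where the strand from an outer endpoint starts. -/
def stackPt : EndPt n → EndPt n ⊕ EndPt n
  | .inl i => .inl (.inl i)
  | .inr i => .inr (.inr i)

theorem isConcat_iff {D E F : AbacusDiagram d n} :
    IsConcat D E F ↔ ∀ p, Strand D E (stackPt p) (F.arc p) (F.beads p) :=
  ⟨fun h p ↦ by rcases p with i | i; exacts [h.1 i, h.2 i],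
    fun h ↦ ⟨fun i ↦ h (.inl i), fun i ↦ h (.inr i)⟩⟩

theorem inr_ne_stackPt {i : Fin n} {p : EndPt n} (h : p ≠ .inr i) :
    stackPt p ≠ .inr (.inr i) := by
  rcases p with j | j <;> simp_all [stackPt]

/-- The beads of a strand after a bead is added on the arc of the lower diagram at the outer
endpoint `inr i`. -/
theorem Strand.addBeads {D E : AbacusDiagram d n} {s : EndPt n ⊕ EndPt n} {q : EndPt n}
    {b : ZMod d} (h : Strand D E s q b) (i : Fin n) (c : ZMod d) :
    Strand D (E.addBeads (Pi.single (.inr i) c)) s q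
      (b + ((if s = .inr (.inr i) then c else 0) + if q = .inr i then c else 0)) := by
  induction h with
  | exit_top p j h => simpa using Strand.exit_top (E := E.addBeads _) p j h
  | go_down p j h q b hs ih =>
    have := Strand.go_down p j h q _ ih
    simpa [add_assoc] using this
  | exit_bottom p j h =>
    have := Strand.exit_bottom (D := D) (E := E.addBeads (Pi.single (.inr i) c)) p j h
    rw [addBeads_beads, h, Pi.single_apply, Pi.single_apply] at this
    simpa using this
  | go_up p j h q b hs ih =>
    have := Strand.go_up (E := E.addBeads (Pi.single (.inr i) c)) p j h q _ ih
    rw [addBeads_beads, h, Pi.single_apply, Pi.single_apply] at this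
    convert this using 1
    simp
    ring

theorem IsConcat.addBeads {D E F : AbacusDiagram d n} (h : IsConcat D E F) (i : Fin n)
    (c : ZMod d) :
    IsConcat D (E.addBeads (Pi.single (.inr i) c)) (F.addBeads (Pi.single (.inr i) c)) := by
  rw [isConcat_iff] at h ⊢
  intro p
  have h1 := (h p).addBeads i c
  have h2 : stackPt p = .inr (.inr i) ↔ p = .inr i := by rcases p with j | j <;> simp [stackPt]
  simpa only [addBeads_arc, addBeads_beads, Pi.single_apply, h2] using h1

theorem mulTangle_arc_of_ne {i : Fin (n - 1)} {E : AbacusDiagram d n} {p : EndPt n}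
    (h1 : p ≠ capL i) (h2 : p ≠ capR i) (h3 : E.arc p ≠ capL i) (h4 : E.arc p ≠ capR i) :
    (mulTangle i E).arc p = E.arc p := by
  rw [mulTangle_arc, capArc, if_neg h1, if_neg h2, if_neg h3, if_neg h4]

theorem mulTangle_beads_of_ne {i : Fin (n - 1)} {E : AbacusDiagram d n} {p : EndPt n}
    (h1 : p ≠ capL i) (h2 : p ≠ capR i) (h3 : E.arc p ≠ capL i) (h4 : E.arc p ≠ capR i) :
    (mulTangle i E).beads p = E.beads p := by
  rw [mulTangle_beads, capBeads, if_neg (by tauto), if_neg h3, if_neg h4]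

/-- The bracket points are outer endpoints, which a strand meets only at its start or its end. A
strand that avoids them there uses only arcs that the tangle leaves alone. -/
theorem Strand.mulTangle {D E : AbacusDiagram d n} {s : EndPt n ⊕ EndPt n} {q : EndPt n}
    {b : ZMod d} {i : Fin (n - 1)} (h : Strand D E s q b) (hs1 : s ≠ .inr (capL i))
    (hs2 : s ≠ .inr (capR i)) (hq1 : q ≠ capL i) (hq2 : q ≠ capR i) :
    Strand D (mulTangle i E) s q b := by
  induction h with
  | exit_top p j h => exact .exit_top p j h
  | go_down p j h q b hs ih => exact .go_down p j h _ _ (ih (by simp) (by simp) hq1 hq2)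
  | exit_bottom p j h =>
    have h1 : p ≠ capL i := fun h ↦ hs1 (congrArg _ h)
    have h2 : p ≠ capR i := fun h ↦ hs2 (congrArg _ h)
    rw [← h] at hq1 hq2
    rw [← mulTangle_beads_of_ne h1 h2 hq1 hq2]
    exact .exit_bottom p j (by rw [mulTangle_arc_of_ne h1 h2 hq1 hq2, h])
  | go_up p j h q b hs ih =>
    have h1 : p ≠ capL i := fun h ↦ hs1 (congrArg _ h)
    have h2 : p ≠ capR i := fun h ↦ hs2 (congrArg _ h)
    have h3 : E.arc p ≠ capL i := by rw [h]; simp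
    have h4 : E.arc p ≠ capR i := by rw [h]; simp
    rw [← mulTangle_beads_of_ne h1 h2 h3 h4]
    exact .go_up p j (by rw [mulTangle_arc_of_ne h1 h2 h3 h4, h]) _ _
      (ih (by simp) (by simp) hq1 hq2)

/-- A strand to one of the two endpoints at a bracket goes on from the other one. -/
theorem Strand.mulTangle_trans {D E : AbacusDiagram d n} {s : EndPt n ⊕ EndPt n} {u v q : EndPt n}
    {b c : ZMod d} {i : Fin (n - 1)} (h : Strand D E s u b) (hs1 : s ≠ .inr (capL i))
    (hs2 : s ≠ .inr (capR i)) (huv : u = capL i ∧ v = capR i ∨ u = capR i ∧ v = capL i)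
    (hv : Strand D E (.inr v) q c) (hq1 : q ≠ capL i) (hq2 : q ≠ capR i) :
    Strand D (AbacusDiagram.mulTangle i E) s q (b + c) := by
  have hlr := capL_ne_capR i
  induction h with
  | exit_top p j h => simp at huv
  | go_down p j h q b hs ih =>
    rw [add_assoc]
    exact .go_down p j h _ _ (ih (by simp) (by simp) huv)
  | exit_bottom p j h =>
    have h1 : p ≠ capL i := fun h ↦ hs1 (congrArg _ h)
    have h2 : p ≠ capR i := fun h ↦ hs2 (congrArg _ h)
    have harc : (AbacusDiagram.mulTangle i E).arc p = E.arc v := by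
      rw [mulTangle_arc, capArc, if_neg h1, if_neg h2, h]
      rcases huv with ⟨h3, rfl⟩ | ⟨h3, rfl⟩
      · rw [if_pos h3]
      · rw [h3, if_neg hlr.symm, if_pos rfl]
    have hbeads : (AbacusDiagram.mulTangle i E).beads p = E.beads p + E.beads v := by
      rw [mulTangle_beads, capBeads, if_neg (by tauto), h]
      rcases huv with ⟨h3, rfl⟩ | ⟨h3, rfl⟩
      · rw [if_pos h3]
      · rw [h3, if_neg hlr.symm, if_pos rfl]
    cases hv with
    | exit_bottom _ k h3 =>
      rw [← hbeads]
      exact .exit_bottom p k (by rw [harc, h3])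
    | go_up _ k h3 _ b hs =>
      rw [← add_assoc, ← hbeads]
      exact .go_up p k (by rw [harc, h3]) _ _ (hs.mulTangle (by simp) (by simp) hq1 hq2)
  | go_up p j h q b hs ih =>
    have h1 : p ≠ capL i := fun h ↦ hs1 (congrArg _ h)
    have h2 : p ≠ capR i := fun h ↦ hs2 (congrArg _ h)
    have h3 : E.arc p ≠ capL i := by rw [h]; simp
    have h4 : E.arc p ≠ capR i := by rw [h]; simp
    rw [← mulTangle_beads_of_ne h1 h2 h3 h4, add_assoc]
    exact .go_up p j (by rw [mulTangle_arc_of_ne h1 h2 h3 h4, h]) _ _ (ih (by simp) (by simp) huv)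

theorem IsConcat.mulTangle {D E F : AbacusDiagram d n} (h : IsConcat D E F) (i : Fin (n - 1)) :
    IsConcat D (E.mulTangle i) (F.mulTangle i) := by
  rw [isConcat_iff] at h ⊢
  intro p
  by_cases h1 : p = capL i
  · rw [h1, mulTangle_arc_capL, mulTangle_beads_capL, ← mulTangle_beads_capL i E]
    exact .exit_bottom _ _ (mulTangle_arc_capL i E)
  by_cases h2 : p = capR i
  · rw [h2, mulTangle_arc_capR, mulTangle_beads_capR, ← mulTangle_beads_capR i E]
    exact .exit_bottom _ _ (mulTangle_arc_capR i E)
  have hs1 : stackPt p ≠ .inr (capL i) := inr_ne_stackPt h1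
  have hs2 : stackPt p ≠ .inr (capR i) := inr_ne_stackPt h2
  by_cases h3 : F.arc p = capL i
  · have h4 : F.arc (capR i) ≠ capL i := fun h5 ↦ h2 (by rw [← F.arc_arc p, h3, ← h5, F.arc_arc])
    have hp := h p
    rw [h3] at hp
    have := hp.mulTangle_trans hs1 hs2 (.inl ⟨rfl, rfl⟩) (h (capR i)) h4 (F.arc_ne _)
    rwa [mulTangle_arc, capArc, if_neg h1, if_neg h2, if_pos h3, mulTangle_beads, capBeads,
      if_neg (by tauto), if_pos h3]
  by_cases h4 : F.arc p = capR i
  · have h5 : F.arc (capL i) ≠ capR i := fun h5 ↦ h1 (by rw [← F.arc_arc p, h4, ← h5, F.arc_arc])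
    have hp := h p
    rw [h4] at hp
    have := hp.mulTangle_trans hs1 hs2 (.inr ⟨rfl, rfl⟩) (h (capL i)) (F.arc_ne _) h5
    rwa [mulTangle_arc, capArc, if_neg h1, if_neg h2, if_neg h3, if_pos h4, mulTangle_beads,
      capBeads, if_neg (by tauto), if_neg h3, if_pos h4]
  rw [mulTangle_arc_of_ne h1 h2 h3 h4, mulTangle_beads_of_ne h1 h2 h3 h4]
  exact (h p).mulTangle hs1 hs2 h3 h4

/-- Induction on `y`: each new letter acts at the bottom of the stack, hence on the lower diagram
and on the concatenation alike. This also yields the existence of concatenations, as `ofJones` is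
surjective for `d > 0`. -/
theorem isConcat_ofJones_mul (x y : FramedJones d n) :
    IsConcat (ofJones x) (ofJones y) (ofJones (x * y)) := by
  induction y using FramedJones.induction_right with
  | one =>
    rw [mul_one]
    exact isConcat_idDiagram _
  | mul_t y i ih =>
    rw [← mul_assoc, ofJones_mul_t, ofJones_mul_t]
    exact ih.mulTangle i
  | mul_z y i ih =>
    rw [← mul_assoc, ofJones_mul_z, ofJones_mul_z]
    exact ih.addBeads i 1

theorem ofJones_t (i : Fin (n - 1)) : ofJones (FramedJones.t d i) = tangle d i := by
  rw [← one_mul (FramedJones.t d i), ofJones_mul_t, ofJones_one]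
  have hlr := leftStrand_ne_rightStrand i
  ext p
  · rw [mulTangle_arc]
    rcases p with j | j
    · by_cases h1 : j = leftStrand i
      · simp [capArc, idDiagram, tangle, tangleArc, h1, hlr]
      · by_cases h2 : j = rightStrand i <;>
          simp [capArc, idDiagram, tangle, tangleArc, h1, h2, hlr.symm]
    · by_cases h1 : j = leftStrand i
      · simp [capArc, tangle, tangleArc, h1, hlr]
      · by_cases h2 : j = rightStrand i <;>
          simp [capArc, idDiagram, tangle, tangleArc, h1, h2, hlr.symm]
  · simp [mulTangle_beads, capBeads, idDiagram, tangle]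

theorem ofJones_z (i : Fin n) : ofJones (FramedJones.z d i) = bead d i := by
  rw [← one_mul (FramedJones.z d i), ofJones_mul_z, ofJones_one]
  ext p
  · rfl
  · rcases p with j | j <;> simp [addBeads_beads, idDiagram, bead, Pi.single_apply]

/-! ### The number of diagrams -/

/-- The numbers of beads on the arcs of a diagram with a given matching. -/
noncomputable def leftBeads (M : NCMatching n) (D : {D : AbacusDiagram d n // D.toMatching = M}) :
    M.LeftEnd → ZMod d :=
  fun k ↦ D.1.beads ((boundaryEquiv n).symm k.1)

theorem leftBeads_injective (M : NCMatching n) : Function.Injective (leftBeads (d := d) M) := by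
  rintro ⟨D, hD⟩ ⟨E, rfl⟩ h
  have harc := toMatching_eq_iff.1 hD
  have key : ∀ p, boundaryPos p < boundaryPos (E.arc p) → D.beads p = E.beads p := by
    intro p hp
    have := congrFun h ⟨boundaryEquiv n p, by rwa [boundaryEquiv_val, toMatching_mate]⟩
    simpa only [leftBeads, Equiv.symm_apply_apply] using this
  refine Subtype.ext (AbacusDiagram.ext harc (funext fun p ↦ ?_))
  rcases lt_or_gt_of_ne ((boundaryPos_injective n).ne (E.arc_ne p)) with hp | hp
  · rw [← D.beads_arc, ← E.beads_arc, harc, key]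
    rwa [E.arc_arc]
  · exact key p hp

theorem leftBeads_surjective (M : NCMatching n) : Function.Surjective (leftBeads (d := d) M) := by
  intro f
  let arc : EndPt n → EndPt n := fun p ↦
    (boundaryEquiv n).symm ⟨M.mate (boundaryPos p), M.mate_lt (boundaryPos_lt p)⟩
  have harc : ∀ p, boundaryPos (arc p) = M.mate (boundaryPos p) := fun p ↦ boundaryPos_symm _
  -- The prescribed beads sit at left ends and the value at right ends is `0`, so the sum over an
  -- arc is the prescribed number.
  let g : ℕ → ZMod d := fun k ↦
    if h : k < M.mate k ∧ k < 2 * n then f ⟨⟨k, h.2⟩, h.1⟩ else 0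
  let D : AbacusDiagram d n :=
    { arc := arc
      beads := fun p ↦ g (boundaryPos p) + g (boundaryPos (arc p))
      arc_arc := fun p ↦ boundaryPos_injective n (by rw [harc, harc, M.mate_mate])
      arc_ne := fun p h ↦ by
        have := harc p
        rw [h] at this
        exact M.mate_ne _ (boundaryPos_lt p) this.symm
      noncrossing := fun p q h ↦ by
        have := M.noncrossing (boundaryPos p) (boundaryPos q)
        rw [← harc, ← harc] at this
        omega
      beads_arc := fun p ↦ by rw [harc (arc p), harc p, M.mate_mate, add_comm] }
  have hD : D.toMatching = M := by
    ext k
    by_cases hk : k < 2 * n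
    · obtain ⟨p, rfl⟩ := exists_boundaryPos_eq hk
      rw [toMatching_mate]
      exact harc p
    · rw [NCMatching.mate_of_le _ _ (not_lt.1 hk), NCMatching.mate_of_le _ _ (not_lt.1 hk)]
  refine ⟨⟨D, hD⟩, funext fun ⟨k, hk⟩ ↦ ?_⟩
  change g (boundaryPos ((boundaryEquiv n).symm k)) +
    g (boundaryPos (arc ((boundaryEquiv n).symm k))) = _
  rw [harc, boundaryPos_symm]
  have h1 : g k.1 = f ⟨k, hk⟩ := dif_pos ⟨hk, k.2⟩
  have h2 : g (M.mate k.1) = 0 := dif_neg fun h ↦ by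
    have := h.1
    rw [M.mate_mate] at this
    omega
  rw [h1, h2, add_zero]

theorem card_eq [NeZero d] : Nat.card (AbacusDiagram d n) = d ^ n * catalan n := by
  have e := fun M : NCMatching n ↦
    Equiv.ofBijective (leftBeads (d := d) M) ⟨leftBeads_injective M, leftBeads_surjective M⟩
  have hcard : ∀ M : NCMatching n,
      Nat.card {D : AbacusDiagram d n // D.toMatching = M} = d ^ n := by
    intro M
    rw [Nat.card_congr (e M), Nat.card_fun, Nat.card_zmod, Nat.card_eq_fintype_card, M.card_leftEnd]
  have : Fintype (NCMatching n) := Fintype.ofFinite _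
  have : ∀ M : NCMatching n, Finite {D : AbacusDiagram d n // D.toMatching = M} :=
    fun M ↦ Finite.of_equiv _ (e M).symm
  rw [← Nat.card_congr (Equiv.sigmaFiberEquiv (toMatching (d := d) (n := n))), Nat.card_sigma,
    Finset.sum_congr rfl fun M _ ↦ hcard M, Finset.sum_const, Finset.card_univ,
    ← Nat.card_eq_fintype_card, NCMatching.card_eq_catalan, smul_eq_mul, mul_comm]

end AbacusDiagram

/-- For `d ≥ 1`, the framed Jones monoid, defined by generators and relations, has
`d ^ n * Cat_n` elements. Moreover the abacus diagrams form a monoid under concatenation, and this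
monoid is isomorphic to the framed Jones monoid by an isomorphism that takes the generators `t_i`
and `z_i` to the tangle and bead diagrams. -/
theorem mainTheorem1 (d n : ℕ) (hd : 0 < d) :
    Nat.card (FramedJones d n) = d ^ n * catalan n ∧
    ∃ _ : Monoid (AbacusDiagram d n),
      (1 : AbacusDiagram d n) = AbacusDiagram.idDiagram d n ∧
      (∀ D E F : AbacusDiagram d n, D * E = F ↔ AbacusDiagram.IsConcat D E F) ∧
      ∃ e : FramedJones d n ≃* AbacusDiagram d n,
        (∀ i : Fin (n - 1), e (FramedJones.t d i) = AbacusDiagram.tangle d i) ∧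
        (∀ i : Fin n, e (FramedJones.z d i) = AbacusDiagram.bead d i) := by
  have : NeZero d := ⟨hd.ne'⟩
  let e := FramedJones.equivDiagram d n
  refine ⟨(Nat.card_congr e).trans AbacusDiagram.card_eq, e.symm.monoid, ?_⟩
  let _ := e.symm.monoid
  have hmul : ∀ D E F : AbacusDiagram d n, D * E = F ↔ AbacusDiagram.IsConcat D E F := by
    intro D E F
    obtain ⟨x, rfl⟩ := e.surjective D
    obtain ⟨y, rfl⟩ := e.surjective E
    have h1 : e x * e y = e (x * y) := by simp [Equiv.mul_def]
    have h2 := AbacusDiagram.isConcat_ofJones_mul x y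
    rw [h1]
    -- The transported product is a concatenation, and uniqueness of concatenations gives the
    -- converse.
    exact ⟨fun h ↦ h ▸ h2, fun h ↦ h2.unique h⟩
  exact ⟨rfl, hmul, e.symm.mulEquiv.symm, AbacusDiagram.ofJones_t, AbacusDiagram.ofJones_z⟩
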